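/- **Conventions.** Write $\mathbb N=\{1,2,3,\dots\}$. Graphs are simple. For an infinite word $\alpha=\alpha_1\alpha_2\alpha_3\cdots$ with letters in $\mathbb N$, let $R^\alpha$ be the infinite graph with path vertices $p_i$ and star nodes $s_i$ ($i\in\mathbb N$), whose edges are $p_ip_{i+1}$ for all $i$ and $s_ip_j$ for all $i,j$ with $\alpha_j=i$. The *path-star class* $\mathcal R^\alpha$ is the class of all finite graphs isomorphic to an induced subgraph of $R^\alpha$. Consider the following words. * $\nu=12\,123\,1234\,12345\cdots$, the concatenation of the blocks $12\cdots k$ for $k=2,3,4,\dots$ * For an integer $q\ge 2$, $\kappa(q)$ is the word whose $n$-th letter is $k(q-1)+j$, where $k$ is the number of trailing zeros of $n$ written in base $q$ and $j\in\{1,\dots,q-1\}$ is the last non-zero digit of $n$ in base $q$. * $\eta=1231412512316\cdots$ is the word whose $n$-th letter is the position, counted from the right, of the last digit $1$ in the Zeckendorf representation of $n$, where the positions $1,2,3,4,5,\dots$ have the weights $1,2,3,5,8,\dots$ The $(t\times t)$-wall has as vertices the integer points $(x,y)$ with $0\le x\le 2t+1$, $0\le y\le t$, where points with $y=0$ are kept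 only if $x$ is even and points with $y=t$ only if $x+t$ is odd; consecutive vertices on a horizontal line are joined (that is, $(x,y)$ and $(x+1,y)$, or $(x,y)$ and $(x+2,y)$ if $(x+1,y)$ is not a vertex), and $(x,y)$ is joined to $(x,y+1)$ if both are vertices and $x+y$ is even. A *subdivision* of a graph is obtained by replacing edges by internally disjoint paths of length at least one through new vertices. A class of graphs is *KKW-free* if there is a $t\in\mathbb N$ such that the class contains no subdivision of $K_t$, no subdivision of $K_{t,t}$, no subdivision of the $(t\times t)$-wall, and no line graph of a subdivision of the $(t\times t)$-wall. A *$t$-sail* is a graph whose vertex set is partitioned into $t$ pairwise non-adjacent star nodes $s_1,\dots,s_t$ and the vertex sets of $t$ induced paths $P_1,\dots,P_t$ with no edges between different paths, such that every path vertex is adjacent to at most one star node and $s_i$ is adjacent to at least one vertex of $P_j$ whenever $1\le i\le j\le t$. **Theorem.** The classes $\mathcal R^{\nu}$, $\mathcal R^{\kappa(q)}$ for every integer $q\ge 2$, and $\mathcal R^{\eta}$ are KKW-free. Moreover, there is a function $f_\nu$ such that for every $t$, every graph in $\mathcal R^\nu$ of tree-width at least $f_\nu(t)$ contains a subdivision of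 a $t$-sail as an induced subgraph. Likewise there are, for every integer $q\ge2$, a function $f_{\kappa(q)}$ for the class $\mathcal R^{\kappa(q)}$, and a function $f_\eta$ for the class $\mathcal R^\eta$, with the same property. -/

import Mathlib

/-- Convention: positions and letters are positive integers, so an infinite word over the alphabet
`ℕ = {1, 2, 3, …}` is a map `ℕ+ → ℕ+`.  A class of graphs is a predicate on simple graphs. -/
abbrev GraphClass : Type 1 := ∀ V : Type, SimpleGraph V → Prop

section Words

/-- The arithmetic word `12 123 1234 12345 …`: the `n`-th letter of the concatenation of the blocks
`1 2 … (k+2)` for `k = 0, 1, 2, …` (the first `n` blocks have at least `n` letters). -/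
def nu (n : ℕ+) : ℕ+ :=
  Nat.toPNat' ((((List.range n).flatMap fun k => List.range' 1 (k + 2))[(n : ℕ) - 1]?).getD 0)

/-- The power word `κ(q)`, `q ≥ 2`: its `n`-th letter is `k (q - 1) + j`, where `k` is the number of
trailing zeros of the `q`-ary representation of `n` and `j` is the last non-zero digit of it. -/
noncomputable def kappa (q : ℕ) (n : ℕ+) : ℕ+ :=
  Nat.toPNat' (multiplicity q (n : ℕ) * (q - 1) + (n : ℕ) / q ^ multiplicity q (n : ℕ) % q)

/-- The Fibonacci type word `1 2 3 1 4 1 2 5 …`: its `n`-th letter is the position, from the right,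
of the last `1` in the Zeckendorf representation of `n`; position `i` has weight `Nat.fib (i + 1)`
(the weights are `1, 2, 3, 5, 8, …`).  `Nat.zeckendorf n` lists the indices of the Fibonacci
numbers of that representation, all at least `2`, in decreasing order. -/
def eta (n : ℕ+) : ℕ+ :=
  Nat.toPNat' ((Nat.zeckendorf n).getLast?.getD 0 - 1)

/-- For `q ≥ 2` the conversion to a positive integer in `kappa` changes nothing. -/
theorem kappa_coe {q : ℕ} (hq : 2 ≤ q) (n : ℕ+) :
    (kappa q n : ℕ) =
      multiplicity q (n : ℕ) * (q - 1) + (n : ℕ) / q ^ multiplicity q (n : ℕ) % q := by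
  have hf : FiniteMultiplicity q (n : ℕ) :=
    Nat.finiteMultiplicity_iff.2 ⟨by omega, n.pos⟩
  obtain ⟨c, hc, hnd⟩ := hf.exists_eq_pow_mul_and_not_dvd
  have hpos : 0 < q ^ multiplicity q (n : ℕ) := by positivity
  have hdiv : (n : ℕ) / q ^ multiplicity q (n : ℕ) = c :=
    Nat.div_eq_of_eq_mul_right hpos hc
  have hmod : 0 < c % q := Nat.pos_of_ne_zero fun h => hnd (Nat.dvd_of_mod_eq_zero h)
  unfold kappa
  rw [Nat.toPNat'_coe, if_pos]
  rw [hdiv]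
  omega

/-- The conversion to a positive integer in `nu` changes nothing. -/
theorem nu_coe (n : ℕ+) :
    (((List.range n).flatMap fun k => List.range' 1 (k + 2))[(n : ℕ) - 1]?) = some (nu n : ℕ) := by
  have hlen : ∀ m : ℕ, m ≤ ((List.range m).flatMap fun k => List.range' 1 (k + 2)).length := by
    intro m
    induction m with
    | zero => simp
    | succ m ih =>
      rw [List.range_succ, List.flatMap_append, List.length_append]
      simp only [List.flatMap_cons, List.flatMap_nil, List.append_nil, List.length_range']
      omega
  have hlt : (n : ℕ) - 1 < ((List.range n).flatMap fun k => List.range' 1 (k + 2)).length :=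
    lt_of_lt_of_le (Nat.sub_lt n.pos one_pos) (hlen n)
  have hpos : 0 < ((List.range n).flatMap fun k => List.range' 1 (k + 2))[(n : ℕ) - 1] := by
    have hm := List.getElem_mem hlt
    rw [List.mem_flatMap] at hm
    obtain ⟨k, -, hk⟩ := hm
    rw [List.mem_range'] at hk
    obtain ⟨i, -, hi⟩ := hk
    omega
  unfold nu
  rw [List.getElem?_eq_getElem hlt, Option.getD_some, Nat.toPNat'_coe, if_pos hpos]

/-- The conversion to a positive integer in `eta` changes nothing. -/
theorem eta_coe (n : ℕ+) : (Nat.zeckendorf n).getLast? = some ((eta n : ℕ) + 1) := by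
  have hne : Nat.zeckendorf n ≠ [] := by
    rw [Nat.zeckendorf_of_pos n.pos]
    simp
  have hge : 2 ≤ (Nat.zeckendorf n).getLast hne := by
    have h := Nat.isZeckendorfRep_zeckendorf n
    unfold List.IsZeckendorfRep at h
    rw [← List.dropLast_append_getLast hne, List.append_assoc] at h
    have h2 := h.right_of_append
    simpa using h2
  unfold eta
  rw [List.getLast?_eq_getLast_of_ne_nil hne, Option.getD_some, Nat.toPNat'_coe,
    if_pos (by omega)]
  congr 1
  omega

end Words

section PathStar

/-- The infinite path-star graph of a word `α`: `Sum.inl i` is the path vertex `p_i`, `Sum.inr i` is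
the star node `s_i`; `p_i` is adjacent to `p_{i+1}`, and `s_i` is adjacent to `p_j` iff `α_j = i`. -/
def pathStarGraph (α : ℕ+ → ℕ+) : SimpleGraph (ℕ+ ⊕ ℕ+) where
  Adj
    | .inl i, .inl j => j = i + 1 ∨ i = j + 1
    | .inl j, .inr i => α j = i
    | .inr i, .inl j => α j = i
    | .inr _, .inr _ => False
  symm := ⟨by
    rintro (i | i) (j | j) h
    · exact h.symm
    · exact h
    · exact h
    · exact h⟩
  loopless := ⟨by
    rintro (i | i) h
    · rcases h with h | h <;> exact absurd (congrArg PNat.val h) (by simp)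
    · exact h⟩

/-- The class of all finite graphs isomorphic to an induced subgraph of `pathStarGraph α`. -/
def pathStarClass (α : ℕ+ → ℕ+) : GraphClass := fun V G =>
  Finite V ∧ Nonempty (G ↪g pathStarGraph α)

end PathStar

section Subdivisions

/-- The data showing that `H` is a subdivision of `G`: the vertices of `G` are vertices of `H`, and
every edge `uv` of `G` is replaced by a path of `H` of length at least one from `u` to `v`; these
paths meet only in common ends, and `H` has no further vertices or edges. -/
structure Subdivision {V W : Type} (G : SimpleGraph V) (H : SimpleGraph W) where
  branch : V → W
  branch_injective : Function.Injective branch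
  path : ∀ u v : V, G.Adj u v → H.Walk (branch u) (branch v)
  isPath : ∀ u v (h : G.Adj u v), (path u v h).IsPath
  path_symm : ∀ u v (h : G.Adj u v), path v u h.symm = (path u v h).reverse
  branch_mem : ∀ u v (h : G.Adj u v) w, branch w ∈ (path u v h).support → w = u ∨ w = v
  disjoint : ∀ u v (h : G.Adj u v) u' v' (h' : G.Adj u' v'), s(u, v) ≠ s(u', v') →
    ∀ x, x ∈ (path u v h).support → x ∈ (path u' v' h').support → x ∈ Set.range branch
  vertex_mem : ∀ x, x ∈ Set.range branch ∨ ∃ u v, ∃ h : G.Adj u v, x ∈ (path u v h).support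
  edge_mem : ∀ x y, H.Adj x y → ∃ u v, ∃ h : G.Adj u v, s(x, y) ∈ (path u v h).edges

/-- `H` is (isomorphic to) a subdivision of `G`. -/
def IsSubdivision {V W : Type} (G : SimpleGraph V) (H : SimpleGraph W) : Prop :=
  Nonempty (Subdivision G H)

end Subdivisions

section KKW

/-- The vertices of the wall with `m` rows of `n` bricks: the grid points `(x, y)` with
`0 ≤ x ≤ 2 n + 1` and `0 ≤ y ≤ m`, where the bottom line `y = 0` and the top line `y = m` contain
only those points from which a vertical edge starts. -/
def wallVertices (m n : ℕ) : Set (ℕ × ℕ) :=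
  {p | p.1 ≤ 2 * n + 1 ∧ p.2 ≤ m ∧ (p.2 = 0 → Even p.1) ∧ (p.2 = m → Odd (p.1 + m))}

/-- The `(m × n)`-wall, `m` rows of bricks each of which is `n` bricks long: horizontal edges join
consecutive vertices of a line, and `(x, y)` is joined to `(x, y + 1)` when `x + y` is even. -/
def wall (m n : ℕ) : SimpleGraph (wallVertices m n) :=
  SimpleGraph.fromRel fun p q =>
    (q.1.2 = p.1.2 ∧ q.1.1 = p.1.1 + 1) ∨
    (q.1.2 = p.1.2 ∧ q.1.1 = p.1.1 + 2 ∧ (p.1.1 + 1, p.1.2) ∉ wallVertices m n) ∨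
    (q.1.1 = p.1.1 ∧ q.1.2 = p.1.2 + 1 ∧ Even (p.1.1 + p.1.2))

/-- For some `t`, the class contains no subdivision of `K_t`, no subdivision of `K_{t,t}`, no
subdivision of the `(t × t)`-wall and no line graph of a subdivision of the `(t × t)`-wall. -/
def KKWFree (C : GraphClass) : Prop :=
  ∃ t : ℕ, ∀ (V : Type) (G : SimpleGraph V), C V G →
    ¬ IsSubdivision (⊤ : SimpleGraph (Fin t)) G ∧
    ¬ IsSubdivision (completeBipartiteGraph (Fin t) (Fin t)) G ∧
    ¬ IsSubdivision (wall t t) G ∧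
    ¬ ∃ (W : Type) (H : SimpleGraph W), IsSubdivision (wall t t) H ∧ Nonempty (G ≃g H.lineGraph)

end KKW

section Treewidth

/-- A tree-decomposition of `G` with tree `tree` on the node set `ι`. -/
structure TreeDecomposition {V : Type} (G : SimpleGraph V) (ι : Type) where
  tree : SimpleGraph ι
  isTree : tree.IsTree
  bag : ι → Set V
  vertex_mem : ∀ v, ∃ i, v ∈ bag i
  edge_mem : ∀ u v, G.Adj u v → ∃ i, u ∈ bag i ∧ v ∈ bag i
  connected : ∀ v, (tree.induce {i | v ∈ bag i}).Preconnected

/-- The largest size of a bag, minus one (truncated at `0`, which matters only when `V` is empty). -/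
noncomputable def TreeDecomposition.width {V ι : Type} {G : SimpleGraph V}
    (D : TreeDecomposition G ι) : ℕ∞ :=
  (⨆ i, (D.bag i).encard) - 1

/-- The tree-width of `G`: the least width of a tree-decomposition. -/
noncomputable def treewidth {V : Type} (G : SimpleGraph V) : ℕ∞ :=
  ⨅ (ι : Type) (D : TreeDecomposition G ι), D.width

end Treewidth

section Sails

/-- `G` is a `t`-sail: its vertices are `t` star nodes `s_i` and the vertices of `t` disjoint path
components `P_j`, every edge lies in one of the paths or joins a star node to a path vertex, every
path vertex is a leaf of at most one star, and `s_i` is adjacent to a vertex of `P_j` whenever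
`i ≤ j`. -/
structure IsSailWith {V : Type} (t : ℕ) (G : SimpleGraph V) (s : Fin t → V) (P : Fin t → Set V) :
    Prop where
  star_injective : Function.Injective s
  star_notMem : ∀ i j, s i ∉ P j
  vertex_mem : ∀ v, (∃ i, v = s i) ∨ ∃ j, v ∈ P j
  isPath : ∀ j, ∃ n : ℕ, Nonempty (G.induce (P j) ≃g SimpleGraph.pathGraph n)
  path_disjoint : ∀ i j, i ≠ j → Disjoint (P i) (P j)
  path_not_adj : ∀ i j, i ≠ j → ∀ u ∈ P i, ∀ v ∈ P j, ¬ G.Adj u v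
  star_not_adj : ∀ i j, ¬ G.Adj (s i) (s j)
  star_unique : ∀ j, ∀ v ∈ P j, ∀ i i', G.Adj (s i) v → G.Adj (s i') v → i = i'
  star_adj : ∀ i j, i ≤ j → ∃ v ∈ P j, G.Adj (s i) v

def IsSail {V : Type} (t : ℕ) (G : SimpleGraph V) : Prop :=
  ∃ (s : Fin t → V) (P : Fin t → Set V), IsSailWith t G s P

/-- Some induced subgraph of `G` is a subdivision of a `t`-sail. -/
def ContainsSubdividedSail {V : Type} (t : ℕ) (G : SimpleGraph V) : Prop :=
  ∃ (W : Type) (S : SimpleGraph W) (U : Set V), IsSail t S ∧ IsSubdivision S (G.induce U)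

end Sails

/-! Two properties of a word carry the proof. The first, `HasDichotomy`, says that an induced
subgraph of the path-star graph either contains `t` stars and `t` non-touching path intervals with
every star attached to every interval, which is already a `t`-sail, or has tree-width bounded in
terms of `t`. This is the sail statement, and for `t = 4` it also excludes walls: a subdivided wall
has maximum degree at most three, so it has no such configuration, while a Helly argument on its
crosses (row and column) makes its tree-width large.

The second, `LinkBound`, excludes subdivisions of complete and complete bipartite graphs. Branch
vertices of degree at least four are star nodes, and the first star met along a subdivided edge is
linked to the star at its start (`exists_linked_of_isPath`), so few branch vertices can have large
degree. Line graphs of subdivided walls contain triangles, whereas consecutive letters of the words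
differ, so that path-star graphs have none.

For the dichotomy, path vertices are removed so that every remaining interval attaches to a bounded
set of stars and removed vertices. The stars and removed vertices have a path-decomposition of
bounded width, and `exists_rootedDecomposition` hangs each remaining interval as a path on one of
its nodes. If the removal would need too many vertices, a sail appears. For `κ(q)` and `η` the
reason is hierarchy: an interval with two high letters contains all the lowest stars, so such
intervals are packed or covered. For `ν`, made of increasing runs, the stars are cut into groups of
`T` consecutive ones: either many runs traverse one group, or each traversal is cut at its first
vertex. -/

/-! ### Subtrees of rooted trees and their Helly property -/

section RootedTrees

variable {ι : Type}

/-- The graph in which every node is joined to its parent. -/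
def parentGraph (par : ι → ι) : SimpleGraph ι :=
  SimpleGraph.fromRel fun i j => par i = j

theorem parentGraph_adj {par : ι → ι} {i j : ι} :
    (parentGraph par).Adj i j ↔ i ≠ j ∧ (par i = j ∨ par j = i) := by
  simp [parentGraph]

/-- `T` contains `r`, and from every other node of `T` the step to the parent decreases the rank and
stays in `T`. -/
def IsSubtreeWithTop (par : ι → ι) (rank : ι → ℕ) (T : Set ι) (r : ι) : Prop :=
  r ∈ T ∧ ∀ i ∈ T, i ≠ r → rank (par i) < rank i ∧ par i ∈ T

namespace IsSubtreeWithTop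

variable {par : ι → ι} {rank : ι → ℕ} {T T₁ T₂ : Set ι} {r r₁ r₂ : ι}

theorem reachable (h : IsSubtreeWithTop par rank T r) (i : ι) (hi : i ∈ T) :
    ((parentGraph par).induce T).Reachable ⟨i, hi⟩ ⟨r, h.1⟩ := by
  induction hn : rank i using Nat.strong_induction_on generalizing i with
  | _ n ih =>
    by_cases hir : i = r
    · subst hir; rfl
    · obtain ⟨h1, h2⟩ := h.2 i hi hir
      refine SimpleGraph.Reachable.trans (SimpleGraph.Adj.reachable ?_)
        (ih _ (hn ▸ h1) (par i) h2 rfl)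
      rw [SimpleGraph.induce_adj, parentGraph_adj]
      exact ⟨fun h => by have h : i = par i := h; rw [← h] at h1; omega, Or.inl rfl⟩

theorem preconnected (h : IsSubtreeWithTop par rank T r) :
    ((parentGraph par).induce T).Preconnected := fun a b =>
  (h.reachable a.1 a.2).trans (h.reachable b.1 b.2).symm

theorem rank_le (h : IsSubtreeWithTop par rank T r) {i : ι} (hi : i ∈ T) : rank r ≤ rank i := by
  induction hn : rank i using Nat.strong_induction_on generalizing i with
  | _ n ih =>
    by_cases hir : i = r
    · subst hir; omega
    · obtain ⟨h1, h2⟩ := h.2 i hi hir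
      have := ih _ (hn ▸ h1) h2 rfl
      omega

/-- Of the tops of two intersecting subtrees, the one of larger rank lies in both of them. -/
theorem top_mem (h₁ : IsSubtreeWithTop par rank T₁ r₁) (h₂ : IsSubtreeWithTop par rank T₂ r₂)
    (hr : rank r₂ ≤ rank r₁) (hne : (T₁ ∩ T₂).Nonempty) : r₁ ∈ T₂ := by
  obtain ⟨z, hz1, hz2⟩ := hne
  induction hn : rank z using Nat.strong_induction_on generalizing z with
  | _ n ih =>
    by_cases hz : z = r₁
    · exact hz ▸ hz2
    · obtain ⟨h1, h2⟩ := h₁.2 z hz1 hz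
      by_cases hz' : z = r₂
      · have := h₁.rank_le h2
        subst hz'; omega
      · exact ih _ (hn ▸ h1) (par z) h2 (h₂.2 z hz2 hz').2 rfl

/-- The top `r₁` of larger rank lies in `T₂` by `top_mem`, so an ascent through `T₁` that arrives at
`r₁` continues inside `T₂` to `r₂`. -/
theorem union (h₁ : IsSubtreeWithTop par rank T₁ r₁) (h₂ : IsSubtreeWithTop par rank T₂ r₂)
    (hr : rank r₂ ≤ rank r₁) (hne : (T₁ ∩ T₂).Nonempty) :
    IsSubtreeWithTop par rank (T₁ ∪ T₂) r₂ := by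
  refine ⟨Or.inr h₂.1, ?_⟩
  have key : ∀ i ∈ T₂, i ≠ r₂ → rank (par i) < rank i ∧ par i ∈ T₁ ∪ T₂ := fun i hi hne =>
    ⟨(h₂.2 i hi hne).1, Or.inr (h₂.2 i hi hne).2⟩
  rintro i (hi | hi) hir
  · by_cases hi1 : i = r₁
    · exact key i (hi1 ▸ h₁.top_mem h₂ hr hne) hir
    · exact ⟨(h₁.2 i hi hi1).1, Or.inl (h₁.2 i hi hi1).2⟩
  · exact key i hi hir

theorem exists_union (h₁ : IsSubtreeWithTop par rank T₁ r₁) (h₂ : IsSubtreeWithTop par rank T₂ r₂)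
    (hne : (T₁ ∩ T₂).Nonempty) : ∃ r, IsSubtreeWithTop par rank (T₁ ∪ T₂) r := by
  rcases le_total (rank r₂) (rank r₁) with h | h
  · exact ⟨_, h₁.union h₂ h hne⟩
  · rw [Set.union_comm]
    exact ⟨_, h₂.union h₁ h (by rwa [Set.inter_comm])⟩

end IsSubtreeWithTop

/-- The Helly property of the subtrees of a rooted tree. -/
theorem exists_mem_of_pairwise_inter {κ : Type} [Finite κ] [Nonempty κ] {par : ι → ι}
    {rank : ι → ℕ} {T : κ → Set ι} (hT : ∀ k, ∃ r, IsSubtreeWithTop par rank (T k) r)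
    (hne : ∀ k l, (T k ∩ T l).Nonempty) : ∃ i, ∀ k, i ∈ T k := by
  choose r hr using hT
  obtain ⟨k, hk⟩ := Finite.exists_max fun k => rank (r k)
  exact ⟨r k, fun l => (hr k).top_mem (hr l) (hk l) (hne k l)⟩

/-- On a cycle, a vertex of maximal rank cannot be the parent of a neighbour, so both its neighbours
on the cycle would be its own parent; but they are distinct. -/
theorem parentGraph_isTree {par : ι → ι} {rank : ι → ℕ} {r : ι} (hr : par r = r)
    (h : IsSubtreeWithTop par rank Set.univ r) : (parentGraph par).IsTree := by
  have hpre : (parentGraph par).Preconnected := by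
    intro a b
    have := (h.preconnected ⟨a, trivial⟩ ⟨b, trivial⟩).map
      (SimpleGraph.Embedding.induce Set.univ).toHom
    simpa using this
  refine ⟨(SimpleGraph.connected_iff _).2 ⟨hpre, ⟨r⟩⟩, ?_⟩
  intro v c hc
  classical
  obtain ⟨u, hu, hmax⟩ := c.support.toFinset.exists_max_image rank ⟨v, by simp⟩
  rw [List.mem_toFinset] at hu
  have key : ∀ w ∈ c.support, (parentGraph par).Adj u w → w = par u := by
    intro w hw hadj
    rw [parentGraph_adj] at hadj
    rcases hadj.2 with h1 | h1
    · exact h1.symm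
    · have h2 : w ≠ r := fun h2 => hadj.1 (by rw [← h1, h2, hr])
      have h3 := (h.2 w trivial h2).1
      have h4 := hmax w (by simpa using hw)
      rw [h1] at h3; omega
  have hc' := hc.rotate hu
  have hnil : ¬ (c.rotate u hu).Nil := hc'.not_nil
  have hmem : ∀ n, (c.rotate u hu).getVert n ∈ c.support := fun n => by
    have := (c.rotate u hu).getVert_mem_support n
    rwa [SimpleGraph.Walk.mem_support_rotate_iff] at this
  exact hc'.snd_ne_penultimate ((key _ (hmem _) ((c.rotate u hu).adj_snd hnil)).trans
    (key _ (hmem _) ((c.rotate u hu).adj_penultimate hnil).symm).symm)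

end RootedTrees

/-! ### Connected vertex sets -/

section WalkConnectedSets

variable {V : Type} {G : SimpleGraph V} {C C' : Set V} {x y z : V}

/-- There is a walk from `x` to `y` inside `C`. -/
def WalkIn (G : SimpleGraph V) (C : Set V) (x y : V) : Prop :=
  ∃ p : G.Walk x y, ∀ z ∈ p.support, z ∈ C

theorem WalkIn.refl (hx : x ∈ C) : WalkIn G C x x := ⟨.nil, by simpa using hx⟩

theorem WalkIn.symm (h : WalkIn G C x y) : WalkIn G C y x := by
  obtain ⟨p, hp⟩ := h
  exact ⟨p.reverse, by simpa using hp⟩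

theorem WalkIn.trans (h : WalkIn G C x y) (h' : WalkIn G C y z) : WalkIn G C x z := by
  obtain ⟨p, hp⟩ := h
  obtain ⟨q, hq⟩ := h'
  refine ⟨p.append q, fun w hw => ?_⟩
  rw [SimpleGraph.Walk.mem_support_append_iff] at hw
  exact hw.elim (hp w) (hq w)

theorem WalkIn.of_adj (h : G.Adj x y) (hx : x ∈ C) (hy : y ∈ C) : WalkIn G C x y :=
  ⟨h.toWalk, by simp [hx, hy]⟩

theorem WalkIn.mono (h : WalkIn G C x y) (hC : C ⊆ C') : WalkIn G C' x y := by
  obtain ⟨p, hp⟩ := h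
  exact ⟨p, fun z hz => hC (hp z hz)⟩

/-- `C` induces a connected subgraph. -/
def IsWalkConnected (G : SimpleGraph V) (C : Set V) : Prop := ∀ x ∈ C, ∀ y ∈ C, WalkIn G C x y

theorem IsWalkConnected.of_base (h : ∀ y ∈ C, WalkIn G C x y) : IsWalkConnected G C :=
  fun y hy z hz => (h y hy).symm.trans (h z hz)

theorem IsWalkConnected.union (h : IsWalkConnected G C) (h' : IsWalkConnected G C')
    (hx : x ∈ C) (hx' : x ∈ C') : IsWalkConnected G (C ∪ C') :=
  .of_base (x := x) fun y hy => hy.elim (fun hy => (h x hx y hy).mono Set.subset_union_left)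
    fun hy => (h' x hx' y hy).mono Set.subset_union_right

end WalkConnectedSets

/-! ### Rooted tree-decompositions -/

/-- A tree-decomposition of `G` whose tree is given by a parent function: the nodes whose bags
contain a fixed vertex form a subtree. -/
structure RootedDecomposition {V : Type} (G : SimpleGraph V) (ι : Type) where
  root : ι
  par : ι → ι
  rank : ι → ℕ
  par_root : par root = root
  isSubtree : IsSubtreeWithTop par rank Set.univ root
  bag : ι → Set V
  top : V → ι
  bag_isSubtree : ∀ v, IsSubtreeWithTop par rank {i | v ∈ bag i} (top v)
  edge_mem : ∀ u v, G.Adj u v → ∃ i, u ∈ bag i ∧ v ∈ bag i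

namespace RootedDecomposition

variable {V ι : Type} {G : SimpleGraph V}

def toTreeDecomposition (D : RootedDecomposition G ι) : TreeDecomposition G ι where
  tree := parentGraph D.par
  isTree := parentGraph_isTree D.par_root D.isSubtree
  bag := D.bag
  vertex_mem v := ⟨D.top v, (D.bag_isSubtree v).1⟩
  edge_mem := D.edge_mem
  connected v := (D.bag_isSubtree v).preconnected

theorem treewidth_le (D : RootedDecomposition G ι) {N : ℕ} (hN : ∀ i, (D.bag i).encard ≤ N) :
    treewidth G ≤ N :=
  (iInf₂_le ι D.toTreeDecomposition).trans (tsub_le_self.trans (iSup_le hN))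

/-- The nodes whose bags meet a given set. -/
def nodes (D : RootedDecomposition G ι) (C : Set V) : Set ι := {i | ∃ v ∈ C, v ∈ D.bag i}

/-- Adjacent vertices share a bag, so the subtrees met along the walk can be united one at a time.
-/
theorem exists_top_nodes_support (D : RootedDecomposition G ι) {u v : V} (p : G.Walk u v) :
    ∃ r, IsSubtreeWithTop D.par D.rank (D.nodes {x | x ∈ p.support}) r := by
  induction p with
  | nil =>
    rename_i u
    refine ⟨D.top u, ?_⟩
    have : D.nodes {x | x ∈ (SimpleGraph.Walk.nil : G.Walk u u).support} = {i | u ∈ D.bag i} := by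
      ext i; simp [nodes]
    rw [this]
    exact D.bag_isSubtree u
  | cons h p ih =>
    rename_i u v w
    obtain ⟨r, hr⟩ := ih
    have : D.nodes {x | x ∈ (SimpleGraph.Walk.cons h p).support} =
        {i | u ∈ D.bag i} ∪ D.nodes {x | x ∈ p.support} := by
      ext i; simp [nodes]
    rw [this]
    refine (D.bag_isSubtree u).exists_union hr ?_
    obtain ⟨i, hi⟩ := D.edge_mem u v h
    exact ⟨i, hi.1, v, by simp, hi.2⟩

/-- The nodes whose bags meet a connected set form a subtree. -/
theorem exists_top_nodes (D : RootedDecomposition G ι) {C : Set V} (hne : C.Nonempty)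
    (hC : IsWalkConnected G C) :
    ∃ r, IsSubtreeWithTop D.par D.rank (D.nodes C) r := by
  -- `C` may be infinite, so no iterated union is available. Instead the top of least rank is taken;
  -- the subtree of any walk in `C` from `v₀` must then have the same top.
  obtain ⟨v₀, hv₀, hmin⟩ :=
    WellFounded.has_min (InvImage.wf (fun v => D.rank (D.top v)) wellFounded_lt) C hne
  have hmin' : ∀ i ∈ D.nodes C, D.rank (D.top v₀) ≤ D.rank i := by
    rintro i ⟨v, hv, hvi⟩
    exact (not_lt.1 (hmin v hv)).trans ((D.bag_isSubtree v).rank_le hvi)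
  refine ⟨D.top v₀, ⟨v₀, hv₀, (D.bag_isSubtree v₀).1⟩, ?_⟩
  rintro i ⟨v, hv, hvi⟩ hi
  obtain ⟨p, hp⟩ := hC v₀ hv₀ v hv
  obtain ⟨r, hr⟩ := D.exists_top_nodes_support p
  have hsub : D.nodes {x | x ∈ p.support} ⊆ D.nodes C := by
    rintro j ⟨x, hx, hxj⟩; exact ⟨x, hp x hx, hxj⟩
  have hrtop : r = D.top v₀ := by
    by_contra hne
    have := hr.2 (D.top v₀) ⟨v₀, by simp, (D.bag_isSubtree v₀).1⟩ (Ne.symm hne)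
    have := hmin' _ (hsub this.2)
    omega
  have := hr.2 i ⟨v, by simp, hvi⟩ (hrtop ▸ hi)
  exact ⟨this.1, hsub this.2⟩

end RootedDecomposition

/-! ### Counting positions and letters from zero -/

section ShiftedWords

/-- The graph of `pathStarGraph`, for words whose positions and letters are counted from `0`. -/
def starPath (a : ℕ → ℕ) : SimpleGraph (ℕ ⊕ ℕ) where
  Adj
    | .inl i, .inl j => j = i + 1 ∨ i = j + 1
    | .inl j, .inr i => a j = i
    | .inr i, .inl j => a j = i
    | .inr _, .inr _ => False
  symm := ⟨by
    rintro (i | i) (j | j) h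
    · exact h.symm
    · exact h
    · exact h
    · exact h⟩
  loopless := ⟨by
    rintro (i | i) h
    · rcases h with h | h <;> omega
    · exact h⟩

/-- The word `α` with positions and letters counted from `0`. -/
def shiftWord (α : ℕ+ → ℕ+) (x : ℕ) : ℕ := (α x.succPNat).natPred

def shiftEmbedding (α : ℕ+ → ℕ+) : pathStarGraph α ↪g starPath (shiftWord α) where
  toFun := Sum.map PNat.natPred PNat.natPred
  inj' := Sum.map_injective.2 ⟨PNat.natPred_injective, PNat.natPred_injective⟩
  map_rel_iff' := by
    have key : ∀ i j : ℕ+, j.natPred = i.natPred + 1 ↔ j = i + 1 := by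
      intro i j
      rw [← PNat.coe_inj, PNat.add_coe, PNat.one_coe, ← PNat.natPred_add_one i,
        ← PNat.natPred_add_one j]
      omega
    rintro (i | i) (j | j)
    · exact or_congr (key i j) (key j i)
    · simp [starPath, pathStarGraph, shiftWord]
    · simp [starPath, pathStarGraph, shiftWord]
    · exact Iff.rfl

end ShiftedWords

/-! ### Stars completely attached to intervals -/

section Bicliques

/-- `U` contains `t` star nodes and `t` intervals of path positions, no two of which touch, such
that each of the star nodes has a neighbour in each of the intervals. -/
def HasBiclique (a : ℕ → ℕ) (U : Set (ℕ ⊕ ℕ)) (t : ℕ) : Prop :=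
  ∃ s l r : Fin t → ℕ, Function.Injective s ∧ (∀ i, Sum.inr (s i) ∈ U) ∧
    (∀ j x, l j ≤ x → x ≤ r j → Sum.inl x ∈ U) ∧
    (∀ j j', j ≠ j' → r j + 1 < l j' ∨ r j' + 1 < l j) ∧
    ∀ i j, ∃ x, l j ≤ x ∧ x ≤ r j ∧ a x = s i

theorem HasBiclique.mono {a : ℕ → ℕ} {U : Set (ℕ ⊕ ℕ)} {t t' : ℕ} (h : HasBiclique a U t)
    (ht : t' ≤ t) : HasBiclique a U t' := by
  obtain ⟨s, l, r, hs, hsU, hU, hsep, hadj⟩ := h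
  have hc := Fin.castLE_injective ht
  exact ⟨s ∘ Fin.castLE ht, l ∘ Fin.castLE ht, r ∘ Fin.castLE ht, hs.comp hc, fun i => hsU _,
    fun j => hU _, fun j j' hj => hsep _ _ (hc.ne hj), fun i j => hadj _ _⟩

/-- Every graph is a subdivision of itself. -/
theorem isSubdivision_self {V : Type} (G : SimpleGraph V) : IsSubdivision G G := by
  refine ⟨{
    branch := id
    branch_injective := Function.injective_id
    path := fun u v h => h.toWalk
    isPath := fun u v h => ?_
    path_symm := fun u v h => ?_
    branch_mem := fun u v h w hw => by simpa using hw
    disjoint := fun u v h u' v' h' hne x _ _ => ⟨x, rfl⟩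
    vertex_mem := fun x => Or.inl ⟨x, rfl⟩
    edge_mem := fun x y h => ⟨x, y, h, by simp⟩ }⟩
  · simpa [SimpleGraph.Walk.isPath_def] using h.ne
  · simp

variable {V : Type} {G : SimpleGraph V} {a : ℕ → ℕ}

/-- The stars and intervals themselves induce a sail, with more adjacencies than required; the
subdivision is trivial. -/
theorem HasBiclique.containsSubdividedSail {e : G ↪g starPath a} {t : ℕ}
    (h : HasBiclique a (Set.range e) t) : ContainsSubdividedSail t G := by
  obtain ⟨s, l, r, hs, hsU, hU, hsep, hadj⟩ := h
  choose σ hσ using hsU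
  let U : Set V := {v | (∃ i, e v = .inr (s i)) ∨ ∃ j x, l j ≤ x ∧ x ≤ r j ∧ e v = .inl x}
  refine ⟨U, G.induce U, U, ⟨fun i => ⟨σ i, Or.inl ⟨i, hσ i⟩⟩,
    fun j => {v | ∃ x, l j ≤ x ∧ x ≤ r j ∧ e v = .inl x}, ?_⟩, isSubdivision_self _⟩
  have hlr : ∀ j, l j ≤ r j := fun j => by
    obtain ⟨x, h1, h2, -⟩ := hadj j j
    exact h1.trans h2
  have hG : ∀ {u v : V} {p q : ℕ ⊕ ℕ}, e u = p → e v = q → (G.Adj u v ↔ (starPath a).Adj p q) := by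
    rintro u v p q rfl rfl
    exact e.map_rel_iff.symm
  refine ⟨?_, ?_, ?_, ?_, ?_, ?_, ?_, ?_, ?_⟩
  · intro i j hij
    have h1 : σ i = σ j := congrArg Subtype.val hij
    have h2 := hσ i
    rw [h1, hσ j] at h2
    exact hs (Sum.inr_injective h2).symm
  · rintro i j ⟨x, -, -, hx⟩
    rw [hσ i] at hx
    cases hx
  · rintro ⟨v, ⟨i, hi⟩ | ⟨j, x, hx⟩⟩
    · exact Or.inl ⟨i, Subtype.ext (e.injective (hi.trans (hσ i).symm))⟩
    · exact Or.inr ⟨j, x, hx⟩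
  · intro j
    choose f hf using fun k : Fin (r j - l j + 1) => hU j (l j + k) (by omega) (by have := hlr j; omega)
    refine ⟨r j - l j + 1, ⟨RelIso.symm
      { toEquiv := Equiv.ofBijective (fun k => ⟨⟨f k, Or.inr ⟨j, l j + k, by omega, by have := hlr j; omega, hf k⟩⟩,
          ⟨l j + k, by omega, by have := hlr j; omega, hf k⟩⟩) ⟨?_, ?_⟩
        map_rel_iff' := ?_ }⟩⟩
    · intro k k' hkk
      have h1 : f k = f k' := congrArg (fun z => z.1.1) hkk
      have h2 := hf k
      rw [h1, hf k'] at h2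
      have := Sum.inl_injective h2
      exact Fin.ext (by omega)
    · rintro ⟨⟨v, hv⟩, x, h1, h2, hx⟩
      refine ⟨⟨x - l j, by omega⟩, ?_⟩
      refine Subtype.ext (Subtype.ext (e.injective ?_))
      change e (f _) = e v
      rw [hf]
      refine Eq.trans ?_ hx.symm
      congr 1
      simp only
      omega
    · intro k k'
      change G.Adj (f k) (f k') ↔ _
      rw [hG (hf k) (hf k'), SimpleGraph.pathGraph_adj]
      change _ ∨ _ ↔ _
      omega
  · intro i j hij
    rw [Set.disjoint_left]
    rintro v ⟨x, h1, h2, hx⟩ ⟨y, h3, h4, hy⟩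
    rw [hx] at hy
    have := Sum.inl_injective hy
    rcases hsep i j hij with h | h <;> omega
  · rintro i j hij u ⟨x, h1, h2, hx⟩ v ⟨y, h3, h4, hy⟩ huv
    have h5 : y = x + 1 ∨ x = y + 1 := (hG hx hy).1 huv
    rcases hsep i j hij with h | h <;> omega
  · intro i j hij
    exact (hG (hσ i) (hσ j)).1 hij
  · rintro j v ⟨x, h1, h2, hx⟩ i i' hi hi'
    have h3 : a x = s i := (hG (hσ i) hx).1 hi
    have h4 : a x = s i' := (hG (hσ i') hx).1 hi'
    exact hs (h3.symm.trans h4)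
  · intro i j _
    obtain ⟨x, h1, h2, hx⟩ := hadj i j
    obtain ⟨v, hv⟩ := hU j x h1 h2
    exact ⟨⟨v, Or.inr ⟨j, x, h1, h2, hv⟩⟩, ⟨x, h1, h2, hv⟩, (hG (hσ i) hv).2 hx⟩

/-- A star node of a biclique has large degree. -/
theorem HasBiclique.exists_degree {e : G ↪g starPath a} {t : ℕ}
    (h : HasBiclique a (Set.range e) (t + 1)) :
    ∃ v, ∃ f : Fin (t + 1) → V, Function.Injective f ∧ ∀ i, G.Adj v (f i) := by
  obtain ⟨s, l, r, hs, hsU, hU, hsep, hadj⟩ := h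
  obtain ⟨v, hv⟩ := hsU 0
  choose x h1 h2 h3 using hadj 0
  choose f hf using fun j => hU j (x j) (h1 j) (h2 j)
  refine ⟨v, f, fun j j' hj => ?_, fun j => ?_⟩
  · by_contra hne
    have h4 := hf j
    rw [hj, hf j'] at h4
    have := Sum.inl_injective h4
    have := h1 j; have := h2 j; have := h1 j'; have := h2 j'
    rcases hsep j j' hne with h | h <;> omega
  · rw [← e.map_rel_iff]
    change (starPath a).Adj (e v) (e (f j))
    rw [hv, hf j]
    exact h3 j

end Bicliques

/-! ### Hanging intervals on a path-decomposition -/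

section Gluing

variable {V : Type} {G : SimpleGraph V} {a : ℕ → ℕ}

/-- A path-decomposition with bags `β n` of the part of `G` outside a set `B` of path vertices
extends to `G` if the neighbours of every component of `B` lie in a single bag `β n`; the number `n`
is given by the function `τ`. -/
theorem exists_rootedDecomposition (e : G ↪g starPath a) (B : Set ℕ) (τ : ℕ → ℕ)
    (β : ℕ → Set (ℕ ⊕ ℕ)) (lo : ℕ ⊕ ℕ → ℕ) {N : ℕ} (hN : ∀ n, (β n).encard ≤ N)
    (hlo : ∀ v ∈ Set.range e, (∀ x ∈ B, v ≠ .inl x) → v ∈ β (lo v))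
    (hβ : ∀ v n, v ∈ β n → n ≠ lo v → 0 < n ∧ v ∈ β (n - 1))
    (hstar : ∀ x, x ∉ B → .inl x ∈ Set.range e → .inr (a x) ∈ Set.range e →
      ∃ n, .inl x ∈ β n ∧ .inr (a x) ∈ β n)
    (hpath : ∀ x, x ∉ B → x + 1 ∉ B → .inl x ∈ Set.range e → .inl (x + 1) ∈ Set.range e →
      ∃ n, .inl x ∈ β n ∧ .inl (x + 1) ∈ β n)
    (hτ : ∀ x ∈ B, x + 1 ∈ B → τ (x + 1) = τ x)
    (hBstar : ∀ x ∈ B, .inr (a x) ∈ Set.range e → .inr (a x) ∈ β (τ x))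
    (hBright : ∀ x ∈ B, x + 1 ∉ B → .inl (x + 1) ∈ Set.range e → .inl (x + 1) ∈ β (τ x))
    (hBleft : ∀ x ∉ B, x + 1 ∈ B → .inl x ∈ Set.range e → .inl x ∈ β (τ (x + 1))) :
    ∃ D : RootedDecomposition G (ℕ ⊕ ℕ), ∀ i, (D.bag i).encard ≤ (N + 2 : ℕ) := by
  classical
  -- The nodes `inl n` form the main path. Each interval of `B` yields a path of nodes `inr x`,
  -- whose first node is joined to the node `inl (τ x)` of the main path. For `x ∉ B` the node `inr
  -- x` is a harmless leaf.
  let par : ℕ ⊕ ℕ → ℕ ⊕ ℕ := Sum.elim (fun n => .inl (n - 1))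
    fun x => if 0 < x ∧ x - 1 ∈ B ∧ x ∈ B then .inr (x - 1) else .inl (τ x)
  -- Since `τ` is constant on intervals of `B`, the rank drops along a hanging path; the summand `1`
  -- makes it drop on entering the main path too.
  let rank : ℕ ⊕ ℕ → ℕ := Sum.elim id fun x => τ x + 1 + x
  let base : ℕ → Set V := fun n => {v | e v ∈ β n ∧ ∀ x ∈ B, e v ≠ .inl x}
  -- Along a hanging path the whole bag of its attachment node is repeated, with `p_x` and `p_{x-1}`
  -- added; hence the surplus of two.
  let bag : ℕ ⊕ ℕ → Set V := Sum.elim base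
    fun x => base (τ x) ∪ {v | x ∈ B ∧ (e v = .inl x ∨ ∃ y ∈ B, y + 1 = x ∧ e v = .inl y)}
  have hrank : ∀ x, rank (par (.inr x)) < rank (.inr x) := by
    intro x
    by_cases hx : 0 < x ∧ x - 1 ∈ B ∧ x ∈ B
    · have h1 := hτ (x - 1) hx.2.1 (by rw [Nat.sub_add_cancel hx.1]; exact hx.2.2)
      rw [Nat.sub_add_cancel hx.1] at h1
      simp only [par, Sum.elim_inr, if_pos hx, rank]
      omega
    · simp only [par, Sum.elim_inr, if_neg hx, rank, Sum.elim_inl, id]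
      omega
  refine ⟨{
    root := .inl 0
    par := par
    rank := rank
    par_root := rfl
    isSubtree := ⟨trivial, ?_⟩
    bag := bag
    top := fun v => if h : ∃ x ∈ B, e v = .inl x then .inr h.choose else .inl (lo (e v))
    bag_isSubtree := ?_
    edge_mem := ?_ }, ?_⟩
  · rintro (n | x) - hne
    · have : n ≠ 0 := fun h => hne (by rw [h])
      exact ⟨by simp only [par, rank, Sum.elim_inl, id]; omega, trivial⟩
    · exact ⟨hrank x, trivial⟩
  · intro v
    by_cases h : ∃ x ∈ B, e v = .inl x
    · rw [dif_pos h]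
      have hc := h.choose_spec
      set x := h.choose
      refine ⟨Or.inr ⟨hc.1, Or.inl hc.2⟩, ?_⟩
      rintro (n | y) hi hne
      · exact absurd hc.2 (hi.2 x hc.1)
      · refine ⟨hrank y, ?_⟩
        rcases hi with hi | ⟨hy, hi | ⟨z, hz, rfl, hi⟩⟩
        · exact absurd hc.2 (hi.2 x hc.1)
        · rw [hc.2] at hi
          exact absurd (congrArg Sum.inr (Sum.inl_injective hi).symm) hne
        · rw [hc.2] at hi
          obtain rfl := Sum.inl_injective hi
          have : par (.inr (x + 1)) = .inr x := by
            simp only [par, Sum.elim_inr]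
            rw [if_pos ⟨by omega, by simpa using hc.1, hy⟩]
            rfl
          rw [this]
          exact Or.inr ⟨hc.1, Or.inl hc.2⟩
    · rw [dif_neg h]
      push Not at h
      refine ⟨⟨hlo _ ⟨v, rfl⟩ h, h⟩, ?_⟩
      rintro (n | y) hi hne
      · have hi : v ∈ base n := hi
        have h1 := hβ _ n hi.1 fun h => hne (by rw [h])
        exact ⟨by simp only [par, rank, Sum.elim_inl, id]; omega, h1.2, h⟩
      · refine ⟨hrank y, ?_⟩
        have h2 : v ∈ base (τ y) := by
          rcases hi with hi | ⟨hy, hi | ⟨z, hz, rfl, hi⟩⟩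
          · exact hi
          · exact absurd hi (h y hy)
          · exact absurd hi (h z hz)
        by_cases hx : 0 < y ∧ y - 1 ∈ B ∧ y ∈ B
        · have h1 := hτ (y - 1) hx.2.1 (by rw [Nat.sub_add_cancel hx.1]; exact hx.2.2)
          rw [Nat.sub_add_cancel hx.1] at h1
          simp only [par, Sum.elim_inr, if_pos hx]
          exact Or.inl (h1 ▸ h2)
        · simp only [par, Sum.elim_inr, if_neg hx]
          exact h2
  · have hone : ∀ u v x, e u = .inl x → e v = .inr (a x) → ∃ i, u ∈ bag i ∧ v ∈ bag i := by
      intro u v x hu hv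
      have hv' : ∀ y ∈ B, e v ≠ .inl y := by rw [hv]; intro y _ h; cases h
      by_cases hx : x ∈ B
      · exact ⟨.inr x, Or.inr ⟨hx, Or.inl hu⟩,
          Or.inl ⟨by rw [hv]; exact hBstar x hx ⟨v, hv⟩, hv'⟩⟩
      · obtain ⟨n, h1, h2⟩ := hstar x hx ⟨u, hu⟩ ⟨v, hv⟩
        refine ⟨.inl n, ⟨by rw [hu]; exact h1, ?_⟩, by rw [hv]; exact h2, hv'⟩
        rintro y hy h
        rw [hu] at h
        exact hx (Sum.inl_injective h ▸ hy)
    have htwo : ∀ u v x, e u = .inl x → e v = .inl (x + 1) → ∃ i, u ∈ bag i ∧ v ∈ bag i := by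
      intro u v x hu hv
      have hout : ∀ {w z}, e w = .inl z → z ∉ B → ∀ y ∈ B, e w ≠ .inl y := by
        intro w z hw hz y hy h
        rw [hw] at h
        exact hz (Sum.inl_injective h ▸ hy)
      by_cases hx : x ∈ B <;> by_cases hx' : x + 1 ∈ B
      · exact ⟨.inr (x + 1), Or.inr ⟨hx', Or.inr ⟨x, hx, rfl, hu⟩⟩, Or.inr ⟨hx', Or.inl hv⟩⟩
      · exact ⟨.inr x, Or.inr ⟨hx, Or.inl hu⟩,
          Or.inl ⟨by rw [hv]; exact hBright x hx hx' ⟨v, hv⟩, hout hv hx'⟩⟩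
      · exact ⟨.inr (x + 1), Or.inl ⟨by rw [hu]; exact hBleft x hx hx' ⟨u, hu⟩, hout hu hx⟩,
          Or.inr ⟨hx', Or.inl hv⟩⟩
      · obtain ⟨n, h1, h2⟩ := hpath x hx hx' ⟨u, hu⟩ ⟨v, hv⟩
        exact ⟨.inl n, ⟨by rw [hu]; exact h1, hout hu hx⟩, by rw [hv]; exact h2, hout hv hx'⟩
    intro u v huv
    rw [← e.map_rel_iff] at huv
    change (starPath a).Adj (e u) (e v) at huv
    rcases hu : e u with x | s <;> rcases hv : e v with y | s' <;> rw [hu, hv] at huv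
    · rcases huv with rfl | rfl
      · exact htwo u v x hu hv
      · obtain ⟨i, h1, h2⟩ := htwo v u y hv hu
        exact ⟨i, h2, h1⟩
    · exact hone u v x hu (hv.trans (congrArg _ (Eq.symm huv)))
    · obtain ⟨i, h1, h2⟩ := hone v u y hv (hu.trans (congrArg _ (Eq.symm huv)))
      exact ⟨i, h2, h1⟩
    · exact huv.elim
  · have hcard : ∀ n x, (e ⁻¹' (β n ∪ {.inl x, .inl (x - 1)})).encard ≤ (N + 2 : ℕ) := by
      intro n x
      rw [← e.injective.encard_image]
      refine (Set.encard_le_encard (Set.image_preimage_subset _ _)).trans ?_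
      refine (Set.encard_union_le _ _).trans ?_
      push_cast
      exact add_le_add (hN n) ((Set.encard_insert_le _ _).trans (by rw [Set.encard_singleton]; norm_num))
    rintro (n | x)
    · exact (Set.encard_le_encard fun v hv => Or.inl hv.1).trans (hcard n 0)
    · refine (Set.encard_le_encard ?_).trans (hcard (τ x) x)
      rintro v (hv | ⟨-, hv | ⟨y, -, rfl, hv⟩⟩)
      · exact Or.inl hv.1
      · exact Or.inr (by simp [hv])
      · exact Or.inr (by simp [hv])

end Gluing

/-! ### Ranks within a set of letters, and interval packing -/

section Counting

variable {p : ℕ → Prop} [DecidablePred p]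

theorem exists_count_eq {i n : ℕ} (h : i < Nat.count p n) : ∃ m < n, p m ∧ Nat.count p m = i := by
  induction n with
  | zero => simp at h
  | succ n ih =>
    by_cases hi : i < Nat.count p n
    · obtain ⟨m, h1, h2⟩ := ih hi
      exact ⟨m, by omega, h2⟩
    · rw [Nat.count_succ] at h
      split_ifs at h with hp
      · exact ⟨n, by omega, hp, by omega⟩
      · omega

theorem count_le_count_add (m d : ℕ) : Nat.count p (m + d) ≤ Nat.count p m + d := by
  induction d with
  | zero => simp
  | succ d ih =>
    rw [← add_assoc, Nat.count_succ]
    split_ifs <;> omega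

theorem encard_setOf_count_le (i k : ℕ) :
    {s | p s ∧ i ≤ Nat.count p s ∧ Nat.count p s < i + k}.encard ≤ k := by
  have h1 : (Finset.Ico i (i + k) : Set ℕ).encard = k := by
    rw [Set.encard_coe_eq_coe_finsetCard, Nat.card_Ico]
    simp
  rw [← h1]
  refine Set.encard_le_encard_of_injOn (f := Nat.count p) ?_ ?_
  · rintro s ⟨-, h2, h3⟩
    simp [h2, h3]
  · rintro s ⟨hs, -⟩ s' ⟨hs', -⟩ h
    exact Nat.count_injective hs hs' h

/-- Greedy packing and covering of intervals: there are `t` intervals with the property `P`, no two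
of which touch, or all intervals with the property `P` are met by some `2 t` points. -/
theorem exists_packing_or_cover (P : ℕ → ℕ → Prop) (hP : ∀ y z, P y z → y ≤ z) (t m : ℕ) :
    (∃ l r : Fin t → ℕ, (∀ j, m ≤ l j) ∧ (∀ j, P (l j) (r j)) ∧
      ∀ j j', j ≠ j' → r j + 1 < l j' ∨ r j' + 1 < l j) ∨
    ∃ X : Set ℕ, X.encard ≤ (2 * t : ℕ) ∧ ∀ y z, m ≤ y → P y z → ∃ x ∈ X, y ≤ x ∧ x ≤ z := by
  classical
  induction t generalizing m with
  | zero => exact Or.inl ⟨Fin.elim0, Fin.elim0, fun j => j.elim0, fun j => j.elim0, fun j => j.elim0⟩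
  | succ t ih =>
    by_cases h : ∃ z y, m ≤ y ∧ P y z
    -- Greedy choice: `z` is the least right end of an admissible interval. The recursion restarts
    -- at `z + 2`, so that later intervals do not touch this one.
    · obtain ⟨y, hy, hyz⟩ := Nat.find_spec h
      have hmin := fun {z'} => Nat.find_min (m := z') h
      generalize Nat.find h = z at hyz hmin
      rcases ih (z + 2) with ⟨l, r, h1, h2, h3⟩ | ⟨X, hX, hcov⟩
      · refine Or.inl ⟨Fin.cons y l, Fin.cons z r, ?_, ?_, ?_⟩
        · refine Fin.cases hy fun j => ?_
          have := h1 j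
          have := hP _ _ hyz
          simp only [Fin.cons_succ]
          omega
        · exact Fin.cases hyz h2
        · refine Fin.cases (Fin.cases (fun h => absurd rfl h) fun j _ => ?_)
            fun j => Fin.cases (fun _ => ?_) fun j' hj => ?_
          · have := h1 j
            simp only [Fin.cons_succ, Fin.cons_zero]
            omega
          · have := h1 j
            simp only [Fin.cons_succ, Fin.cons_zero]
            omega
          · simpa using h3 j j' (by simpa using hj)
      -- By minimality of `z`, an admissible interval starting before `z + 2` contains `z` or starts
      -- at `z + 1`.
      · refine Or.inr ⟨insert z (insert (z + 1) X), ?_, ?_⟩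
        · refine (Set.encard_insert_le _ _).trans ?_
          refine (add_le_add_left (Set.encard_insert_le _ _) 1).trans ?_
          refine (add_le_add_left (add_le_add_left hX 1) 1).trans ?_
          norm_cast
        · intro y' z' hy' hyz'
          have h1 : z ≤ z' := by
            by_contra hlt
            exact hmin (not_le.1 hlt) ⟨y', hy', hyz'⟩
          have h2 := hP _ _ hyz'
          by_cases h3 : y' ≤ z
          · exact ⟨z, by simp, h3, h1⟩
          · by_cases h4 : y' = z + 1
            · exact ⟨z + 1, by simp, by omega, by omega⟩
            · obtain ⟨x, hx, h5⟩ := hcov y' z' (by omega) hyz'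
              exact ⟨x, by simp [hx], h5⟩
    · refine Or.inr ⟨∅, by simp, fun y z hy hyz => absurd ⟨z, y, hy, hyz⟩ h⟩

end Counting

/-! ### Hierarchical words -/

section WordProperties

/-- Induced subgraphs of the graph of `a` have a large biclique of stars and paths or a
tree-decomposition of bounded width. -/
def HasDichotomy (a : ℕ → ℕ) : Prop :=
  ∀ t : ℕ, ∃ N : ℕ, ∀ (V : Type) (G : SimpleGraph V) (e : G ↪g starPath a),
    HasBiclique a (Set.range e) t ∨
      ∃ D : RootedDecomposition G (ℕ ⊕ ℕ), ∀ i, (D.bag i).encard ≤ N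

/-- The letters `s` and `u` occur at the ends of a factor of `a` without letters of `S` inside. -/
def Linked (a : ℕ → ℕ) (S : Set ℕ) (s u : ℕ) : Prop :=
  ∃ y z, y < z ∧ (a y = s ∧ a z = u ∨ a y = u ∧ a z = s) ∧ ∀ x, y < x → x < z → a x ∉ S

/-- In each set `S` of letters all but `c` letters are linked to at most `D` letters of `S`. -/
def LinkBound (a : ℕ → ℕ) (c D : ℕ) : Prop :=
  ∀ S : Set ℕ, ∃ C : Set ℕ, C.encard ≤ c ∧
    ∀ s ∈ S, s ∉ C → {u | u ∈ S ∧ u ≠ s ∧ Linked a S s u}.encard ≤ D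

/-- A factor of `a` with two letters `≥ l + c` contains the letter `l`. -/
def IsHierarchical (a : ℕ → ℕ) (c : ℕ) : Prop :=
  ∀ l y z, y < z → l + c ≤ a y → l + c ≤ a z → ∃ x, y ≤ x ∧ x ≤ z ∧ a x = l

theorem encard_setOf_lt_add (m c : ℕ) : {s : ℕ | m ≤ s ∧ s < m + c}.encard ≤ c := by
  have h : {s : ℕ | m ≤ s ∧ s < m + c} = (Finset.Ico m (m + c) : Set ℕ) := by
    ext; simp
  rw [h, Set.encard_coe_eq_coe_finsetCard, Nat.card_Ico]
  simp

/-- Between two letters that are both at least `min S + c`, the letter `min S` occurs and breaks the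
link. So a letter outside the window `[min S, min S + c)` is linked only to letters in the window.
-/
theorem IsHierarchical.linkBound {a : ℕ → ℕ} {c : ℕ} (h : IsHierarchical a c) (hc : 0 < c) :
    LinkBound a c c := by
  intro S
  refine ⟨{s | sInf S ≤ s ∧ s < sInf S + c}, encard_setOf_lt_add _ _, fun s hs hsC => ?_⟩
  refine (Set.encard_le_encard ?_).trans (encard_setOf_lt_add (sInf S) c)
  rintro u ⟨hu, -, y, z, hyz, hends, hint⟩
  have hS : sInf S ∈ S := Nat.sInf_mem ⟨s, hs⟩
  have hsm : sInf S + c ≤ s := by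
    have := Nat.sInf_le hs
    by_contra hlt
    exact hsC ⟨this, by omega⟩
  refine ⟨Nat.sInf_le hu, ?_⟩
  by_contra hlt
  have hy : sInf S + c ≤ a y := by rcases hends with h | h <;> omega
  have hz : sInf S + c ≤ a z := by rcases hends with h | h <;> omega
  obtain ⟨x, h1, h2, h3⟩ := h _ y z hyz hy hz
  refine hint x ?_ ?_ (h3 ▸ hS)
  · rcases h1.eq_or_lt with rfl | h1
    · omega
    · exact h1
  · rcases h2.eq_or_lt with rfl | h2
    · omega
    · exact h2

/-- `x` and `y` lie in an interval contained in `B`. -/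
def SameInterval (B : Set ℕ) (x y : ℕ) : Prop :=
  ∃ l r, l ≤ x ∧ l ≤ y ∧ x ≤ r ∧ y ≤ r ∧ ∀ w, l ≤ w → w ≤ r → w ∈ B

theorem SameInterval.refl {B : Set ℕ} {x : ℕ} (hx : x ∈ B) : SameInterval B x x :=
  ⟨x, x, le_rfl, le_rfl, le_rfl, le_rfl, fun w h1 h2 => by rwa [le_antisymm h2 h1]⟩

theorem SameInterval.symm {B : Set ℕ} {x y : ℕ} (h : SameInterval B x y) : SameInterval B y x := by
  obtain ⟨l, r, h1, h2, h3, h4, h5⟩ := h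
  exact ⟨l, r, h2, h1, h4, h3, h5⟩

theorem SameInterval.trans {B : Set ℕ} {x y z : ℕ} (h : SameInterval B x y)
    (h' : SameInterval B y z) : SameInterval B x z := by
  obtain ⟨l, r, h1, h2, h3, h4, h5⟩ := h
  obtain ⟨l', r', h1', h2', h3', h4', h5'⟩ := h'
  refine ⟨min l l', max r r', by omega, by omega, by omega, by omega, fun w hw hw' => ?_⟩
  by_cases h6 : l ≤ w ∧ w ≤ r
  · exact h5 w h6.1 h6.2
  · exact h5' w (by omega) (by omega)

/-- An interval with two big letters meets the `t` lowest stars. Either `t` such intervals can be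
packed, or `2 t` points hit them all; then each remaining interval has at most one position with a
big letter, so it attaches to one big star besides the few small stars and cutting points. -/
theorem IsHierarchical.hasDichotomy {a : ℕ → ℕ} {c : ℕ} (h : IsHierarchical a c) :
    HasDichotomy a := by
  classical
  intro t
  -- The small stars, the cutting points, one big star, and two path vertices from the gluing.
  refine ⟨t + c + 2 * t + 1 + 2, fun V G e => ?_⟩
  set U := Set.range e
  let S : ℕ → Prop := fun s => .inr s ∈ U
  -- The surplus `c` puts a big letter at distance at least `c` above each of the `t` lowest stars,
  -- as the hierarchy demands.
  let big : ℕ → Prop := fun s => S s ∧ t + c ≤ Nat.count S s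
  let P : ℕ → ℕ → Prop := fun y z =>
    y < z ∧ big (a y) ∧ big (a z) ∧ ∀ x, y ≤ x → x ≤ z → .inl x ∈ U
  have hbig : ∀ s, big s → ∀ l, S l → Nat.count S l < t → l + c ≤ s := by
    intro s hs l hl hlt
    have h1 := hs.2
    by_contra hcon
    have h2 := Nat.count_monotone S (show s ≤ l + c by omega)
    have h3 := count_le_count_add (p := S) l c
    omega
  rcases exists_packing_or_cover P (fun y z h => h.1.le) t 0 with ⟨l, r, -, hP, hsep⟩ | ⟨X, hX, hcov⟩
  · left
    rcases Nat.eq_zero_or_pos t with rfl | ht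
    · exact ⟨Fin.elim0, Fin.elim0, Fin.elim0, fun i => i.elim0, fun i => i.elim0, fun i => i.elim0,
        fun i => i.elim0, fun i => i.elim0⟩
    have hb := (hP ⟨0, ht⟩).2.1
    have hex : ∀ i : Fin t, ∃ m, S m ∧ Nat.count S m = i := fun i => by
      obtain ⟨m, -, hm⟩ := exists_count_eq (p := S) (i := i) (n := a (l ⟨0, ht⟩))
        (by have := hb.2; have := i.2; omega)
      exact ⟨m, hm⟩
    choose s hsS hs using hex
    refine ⟨s, l, r, fun i j hij => ?_, hsS, fun j => (hP j).2.2.2, hsep, fun i j => ?_⟩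
    · have h1 := hs i
      rw [hij, hs j] at h1
      exact Fin.ext h1.symm
    · obtain ⟨h1, h2, h3, -⟩ := hP j
      exact h _ _ _ h1 (hbig _ h2 _ (hsS i) (by rw [hs]; exact i.2))
        (hbig _ h3 _ (hsS i) (by rw [hs]; exact i.2))
  · right
    let B : Set ℕ := {x | .inl x ∈ U ∧ x ∉ X}
    -- The node `n` of the main path is reserved for the big star `n`. Intervals without a big
    -- letter may hang anywhere, since small stars and cutting points lie in every bag; they get
    -- node `0`.
    let τ : ℕ → ℕ := fun x =>
      if h : ∃ y, SameInterval B x y ∧ big (a y) then a h.choose else 0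
    have hτ : ∀ x y, SameInterval B x y → big (a y) → τ x = a y := by
      intro x y hxy hy
      have hex : ∃ y, SameInterval B x y ∧ big (a y) := ⟨y, hxy, hy⟩
      simp only [τ, dif_pos hex]
      obtain ⟨h1, h2⟩ := hex.choose_spec
      obtain ⟨l, r, h3, h4, h5, h6, h7⟩ := h1.symm.trans hxy
      congr 1
      by_contra hne
      have key : ∀ y z, y < z → l ≤ y → z ≤ r → big (a y) → big (a z) → False := by
        intro y z hyz hl hr hy hz
        obtain ⟨w, hw, hw1, hw2⟩ := hcov y z (Nat.zero_le _)
          ⟨hyz, hy, hz, fun x h8 h9 => (h7 x (by omega) (by omega)).1⟩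
        exact (h7 w (by omega) (by omega)).2 hw
      rcases lt_or_gt_of_ne hne with hlt | hlt
      · exact key _ _ hlt h3 h6 h2 hy
      · exact key _ _ hlt h4 h5 hy h2
    have hτ0 : ∀ x, (¬ ∃ y, SameInterval B x y ∧ big (a y)) → τ x = 0 := fun x hx => dif_neg hx
    have hsmall : ∀ s, S s → ¬ big s → Nat.count S s < t + c := fun s hs hb => by
      by_contra hlt
      exact hb ⟨hs, not_lt.1 hlt⟩
    refine exists_rootedDecomposition e B τ
      (fun n => (Sum.inr '' {s | S s ∧ Nat.count S s < t + c} ∪ Sum.inl '' X) ∪ {v | v = .inr n ∧ big n})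
      (fun v => Sum.elim (fun _ => 0) (fun s => if big s then s else 0) v)
      ?_ ?_ ?_ ?_ ?_ ?_ ?_ ?_ ?_
    · intro n
      refine (Set.encard_union_le _ _).trans ?_
      rw [Nat.cast_add _ 1]
      refine add_le_add ?_ ((Set.encard_le_encard fun v hv => hv.1).trans
        (Set.encard_singleton (Sum.inr n : ℕ ⊕ ℕ)).le)
      refine (Set.encard_union_le _ _).trans ?_
      push_cast
      rw [Sum.inr_injective.encard_image, Sum.inl_injective.encard_image]
      refine add_le_add ?_ (by exact_mod_cast hX)
      have := encard_setOf_count_le (p := S) 0 (t + c)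
      simpa using this
    · rintro (x | s) hv hB
      · refine Or.inl (Or.inr ⟨x, ?_, rfl⟩)
        by_contra hx
        exact hB x ⟨hv, hx⟩ rfl
      · by_cases hb : big s
        · right; simp [hb]
        · exact Or.inl (Or.inl ⟨s, ⟨hv, hsmall s hv hb⟩, rfl⟩)
    · rintro v n ((⟨s, hs, rfl⟩ | ⟨x, hx, rfl⟩) | hv) hn
      · have hnb : ¬ big s := fun hb => by have := hb.2; have := hs.2; omega
        simp only [Sum.elim_inr, if_neg hnb] at hn
        exact ⟨by omega, Or.inl (Or.inl ⟨s, hs, rfl⟩)⟩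
      · simp only [Sum.elim_inl] at hn
        exact ⟨by omega, Or.inl (Or.inr ⟨x, hx, rfl⟩)⟩
      · obtain ⟨rfl, hb⟩ := hv
        simp [hb] at hn
    · intro x hxB hxU hs
      have hx : x ∈ X := by
        by_contra hx
        exact hxB ⟨hxU, hx⟩
      refine ⟨a x, Or.inl (Or.inr ⟨x, hx, rfl⟩), ?_⟩
      by_cases hb : big (a x)
      · exact Or.inr ⟨rfl, hb⟩
      · exact Or.inl (Or.inl ⟨a x, ⟨hs, hsmall _ hs hb⟩, rfl⟩)
    · intro x hxB hxB' hxU hxU'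
      refine ⟨0, Or.inl (Or.inr ⟨x, ?_, rfl⟩), Or.inl (Or.inr ⟨x + 1, ?_, rfl⟩)⟩
      · by_contra hx
        exact hxB ⟨hxU, hx⟩
      · by_contra hx
        exact hxB' ⟨hxU', hx⟩
    · intro x hx hx'
      have hcon : SameInterval B x (x + 1) := ⟨x, x + 1, by omega, by omega, by omega, by omega,
        fun w h1 h2 => by
          rcases h1.eq_or_lt with rfl | h1
          · exact hx
          · rwa [show w = x + 1 by omega]⟩
      by_cases hex : ∃ y, SameInterval B x y ∧ big (a y)
      · obtain ⟨y, hy, hb⟩ := hex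
        rw [hτ _ y hy hb, hτ _ y (hcon.symm.trans hy) hb]
      · rw [hτ0 x hex, hτ0]
        rintro ⟨y, hy, hb⟩
        exact hex ⟨y, hcon.trans hy, hb⟩
    · intro x hx hs
      by_cases hb : big (a x)
      · rw [hτ x x (.refl hx) hb]
        exact Or.inr ⟨rfl, hb⟩
      · exact Or.inl (Or.inl ⟨a x, ⟨hs, hsmall _ hs hb⟩, rfl⟩)
    · intro x hx hx' hU
      refine Or.inl (Or.inr ⟨x + 1, ?_, rfl⟩)
      by_contra hX'
      exact hx' ⟨hU, hX'⟩
    · intro x hx hx' hU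
      refine Or.inl (Or.inr ⟨x, ?_, rfl⟩)
      by_contra hX'
      exact hx ⟨hU, hX'⟩

end WordProperties

/-! ### Words made of increasing runs -/

section Sawtooth

/-- `a` is a concatenation of blocks of the form `0 1 2 … k`. -/
def IsSawtooth (a : ℕ → ℕ) : Prop := a 0 = 0 ∧ ∀ x, a (x + 1) = a x + 1 ∨ a (x + 1) = 0

namespace IsSawtooth

variable {a : ℕ → ℕ}

theorem le_self (h : IsSawtooth a) (x : ℕ) : a x ≤ x := by
  induction x with
  | zero => exact h.1.le
  | succ x ih => rcases h.2 x with h | h <;> omega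

/-- A positive letter is never the result of a reset, so reading backwards the letters descend by
one until the start of the run. -/
theorem sub (h : IsSawtooth a) {x i : ℕ} (hi : i ≤ a x) : a (x - i) + i = a x := by
  induction i with
  | zero => simp
  | succ i ih =>
    have h1 := ih (by omega)
    have h2 := h.le_self x
    have h3 := h.2 (x - (i + 1))
    rw [show x - (i + 1) + 1 = x - i by omega] at h3
    omega

theorem le_add (h : IsSawtooth a) (x d : ℕ) : a (x + d) ≤ a x + d := by
  induction d with
  | zero => simp
  | succ d ih => rcases h.2 (x + d) with h | h <;> rw [← add_assoc] <;> omega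

theorem add_of_le (h : IsSawtooth a) {x m i : ℕ} (hm : a (x + m) = a x + m) (hi : i ≤ m) :
    a (x + i) = a x + i := by
  have h1 := h.le_add x i
  have h2 := h.le_add (x + i) (m - i)
  rw [show x + i + (m - i) = x + m by omega] at h2
  omega

/-- Of two successive occurrences of letters in `S`, the second continues the run of the first, and
is then the next element of `S`, or lies in a later run, and is then `min S`. So `s ≠ min S` is
linked only to its predecessor and successor in `S` and to `min S`. -/
theorem linkBound (h : IsSawtooth a) : LinkBound a 1 3 := by
  intro S
  refine ⟨{sInf S}, by simp, fun s hs hsC => ?_⟩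
  have hS : sInf S ∈ S := Nat.sInf_mem ⟨s, hs⟩
  have key : ∀ y z, y < z → a y ∈ S → a z ∈ S → (∀ x, y < x → x < z → a x ∉ S) →
      a z = sInf S ∨ a y < a z ∧ ∀ w ∈ S, a y < w → ¬ w < a z := by
    intro y z hyz hy hz hint
    by_cases hzy : z - a z ≤ y
    · right
      have h1 := h.sub (x := z) (i := z - y) (by omega)
      rw [show z - (z - y) = y by omega] at h1
      refine ⟨by omega, fun w hw h2 h3 => hint (y + (w - a y)) (by omega) (by omega) ?_⟩
      rw [h.add_of_le (m := z - y) (by rw [Nat.add_sub_cancel' hyz.le]; omega) (by omega)]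
      rwa [show a y + (w - a y) = w by omega]
    · left
      refine le_antisymm ?_ (Nat.sInf_le hz)
      by_contra hlt
      have h1 := h.sub (x := z) (i := a z - sInf S) (by omega)
      refine hint (z - (a z - sInf S)) (by omega) (by omega) ?_
      rwa [show a (z - (a z - sInf S)) = sInf S by omega]
  have hone : ∀ W : Set ℕ, (∀ u ∈ W, ∀ v ∈ W, u = v) → W.encard ≤ 1 := fun W hW => by
    rw [Set.encard_le_one_iff]
    exact fun u v hu hv => hW u hu v hv
  have hsub : {u | u ∈ S ∧ u ≠ s ∧ Linked a S s u} ⊆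
      ({sInf S} ∪ {u | u ∈ S ∧ s < u ∧ ∀ w ∈ S, s < w → ¬ w < u}) ∪
        {u | u ∈ S ∧ u < s ∧ ∀ w ∈ S, u < w → ¬ w < s} := by
    rintro u ⟨hu, -, y, z, hyz, ⟨rfl, rfl⟩ | ⟨rfl, rfl⟩, hint⟩
    · rcases key y z hyz hs hu hint with h1 | h1
      · exact Or.inl (Or.inl h1)
      · exact Or.inl (Or.inr ⟨hu, h1⟩)
    · rcases key y z hyz hu hs hint with h1 | h1
      · exact absurd h1 hsC
      · exact Or.inr ⟨hu, h1⟩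
  refine (Set.encard_le_encard hsub).trans ((Set.encard_union_le _ _).trans ?_)
  refine (add_le_add ((Set.encard_union_le _ _).trans (add_le_add (Set.encard_singleton _).le
    (hone _ ?_))) (hone _ ?_)).trans (by norm_num)
  · rintro u ⟨hu, h1, h2⟩ v ⟨hv, h3, h4⟩
    exact le_antisymm (not_lt.1 (h2 v hv h3)) (not_lt.1 (h4 u hu h1))
  · rintro u ⟨hu, h1, h2⟩ v ⟨hv, h3, h4⟩
    by_contra hne
    rcases lt_or_gt_of_ne hne with hlt | hlt
    · exact h2 v hv hlt h3
    · exact h4 u hu hlt h1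

/-- The positive star letters are divided into groups of `T` consecutive ones, and `X j` collects
the starts of the traversals of group `j` present in the graph. More than `T` traversals of one
group form a biclique. Otherwise all `X j` are removed, and no remaining interval traverses a whole
group: it attaches to groups `q` and `q + 1`, where `q` is the group at its left end, and after a
reset to group `0`. -/
theorem hasDichotomy (h : IsSawtooth a) : HasDichotomy a := by
  classical
  intro t
  -- With groups of at least two letters, no two removed positions are consecutive.
  obtain ⟨T, hT, hT2⟩ : ∃ T, t ≤ T ∧ 2 ≤ T := ⟨t + 2, by omega, by omega⟩
  refine ⟨1 + 2 * T + 2 * T + 2 * T + 2, fun V G e => ?_⟩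
  set U := Set.range e
  -- The letter `0` is set aside: a traversal starting at `0` could directly follow the previous
  -- one, so that the two intervals touch. The star of letter `0` is put in all bags instead.
  let S : ℕ → Prop := fun s => .inr s ∈ U ∧ 1 ≤ s
  let cnt : ℕ → ℕ := Nat.count S
  have hmono : ∀ {m n}, m ≤ n → cnt m ≤ cnt n := fun h => Nat.count_monotone S h
  have hstrict : ∀ {m n}, S m → m < n → cnt m < cnt n := fun hm h => Nat.count_strict_mono hm h
  have hsucc : ∀ {m}, S m → cnt (m + 1) = cnt m + 1 := fun hm => by
    simp only [cnt, Nat.count_succ, if_pos hm]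
  let X : ℕ → Set ℕ := fun j => {x | S (a x) ∧ cnt (a x) = j * T ∧ ∃ m, a (x + m) = a x + m ∧
    S (a x + m) ∧ cnt (a x + m) = j * T + (T - 1) ∧ ∀ i ≤ m, .inl (x + i) ∈ U}
  by_cases hX : ∀ j, (X j).encard ≤ T
  swap
  · left
    refine HasBiclique.mono ?_ hT
    push Not at hX
    obtain ⟨j, hj⟩ := hX
    obtain ⟨F, hFX, hF⟩ := Set.exists_subset_encard_eq hj.le
    have hFfin : F.Finite := Set.finite_of_encard_eq_coe hF
    have hcard : hFfin.toFinset.card = T := by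
      have := hFfin.encard_eq_coe_toFinset_card
      rw [hF] at this
      exact_mod_cast this.symm
    let f : Fin T → ℕ := hFfin.toFinset.orderEmbOfFin hcard
    have hfinj : Function.Injective f := (hFfin.toFinset.orderEmbOfFin hcard).injective
    have hf : ∀ k, f k ∈ X j := fun k => hFX
      (hFfin.mem_toFinset.1 (Finset.orderEmbOfFin_mem hFfin.toFinset hcard k))
    obtain ⟨hS0, hc0, m, hm, hSm, hcm, -⟩ := hf ⟨0, by omega⟩
    set l := a (f ⟨0, by omega⟩)
    have hl : ∀ x ∈ X j, a x = l ∧ a (x + m) = a x + m ∧ ∀ i ≤ m, .inl (x + i) ∈ U := by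
      rintro x ⟨h1, h2, m', h3, h4, h5, h6⟩
      have h7 : a x = l := Nat.count_injective h1 hS0 (h2.trans hc0.symm)
      have h8 : a x + m' = l + m := Nat.count_injective h4 hSm (h5.trans hcm.symm)
      obtain rfl : m' = m := by omega
      exact ⟨h7, h3, h6⟩
    have hsep : ∀ x ∈ X j, ∀ x' ∈ X j, x < x' → x + m + 1 < x' := by
      intro x hx x' hx' hlt
      obtain ⟨h1, h2, -⟩ := hl x hx
      obtain ⟨h3, -, -⟩ := hl x' hx'
      by_contra hcon
      by_cases h4 : x' ≤ x + m
      · have h5 := h.add_of_le h2 (i := x' - x) (by omega)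
        rw [Nat.add_sub_cancel' hlt.le] at h5
        omega
      · have h5 := h.2 (x + m)
        rw [show x + m + 1 = x' by omega] at h5
        have := hS0.2
        omega
    have hex : ∀ i : Fin T, ∃ s, S s ∧ cnt s = j * T + i := fun i => by
      obtain ⟨s, -, hs⟩ := exists_count_eq (p := S) (i := j * T + i) (n := l + m + 1) (by
        have : Nat.count S (l + m + 1) = cnt (l + m) + 1 := hsucc hSm
        have := i.2
        omega)
      exact ⟨s, hs⟩
    choose s hsS hs using hex
    refine ⟨s, f, fun k => f k + m, fun i i' hi => ?_, fun i => (hsS i).1, fun k x h1 h2 => ?_,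
      fun k k' hk => ?_, fun i k => ?_⟩
    · have h1 := hs i
      rw [hi, hs i'] at h1
      exact Fin.ext (by omega)
    · have := (hl _ (hf k)).2.2 (x - f k) (by change x ≤ f k + m at h2; omega)
      rwa [Nat.add_sub_cancel' h1] at this
    · rcases lt_or_gt_of_ne (hfinj.ne hk) with hlt | hlt
      · exact Or.inl (hsep _ (hf k) _ (hf k') hlt)
      · exact Or.inr (hsep _ (hf k') _ (hf k) hlt)
    · obtain ⟨h1, h2, -⟩ := hl _ (hf k)
      have h3 : l ≤ s i := by
        by_contra hlt
        have := hstrict (hsS i) (not_le.1 hlt)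
        have := hs i
        omega
      have h4 : s i ≤ l + m := by
        by_contra hlt
        have := hstrict hSm (not_le.1 hlt)
        have := hs i
        have := i.2
        omega
      refine ⟨f k + (s i - l), by omega, by change _ ≤ f k + m; omega, ?_⟩
      rw [h.add_of_le h2 (by omega)]
      omega
  · right
    let B : Set ℕ := {x | .inl x ∈ U ∧ ∀ j, x ∉ X j}
    -- On an interval of `B`, `τ` keeps the group number of the letter at its left end.
    let τ : ℕ → ℕ := fun x =>
      Nat.rec 0 (fun x r => if x ∈ B then r else cnt (a (x + 1)) / T) x
    have hτ0 : τ 0 = 0 := rfl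
    have hτB : ∀ x, x ∈ B → τ (x + 1) = τ x := fun x hx => if_pos hx
    have hτB' : ∀ x, x ∉ B → τ (x + 1) = cnt (a (x + 1)) / T := fun x hx => if_neg hx
    have hleft : ∀ x ∈ B, ∃ L ≤ x, (∀ w, L ≤ w → w ≤ x → w ∈ B) ∧ τ x = cnt (a L) / T := by
      intro x hx
      induction x with
      | zero =>
        refine ⟨0, le_rfl, fun w _ hw => by rwa [Nat.le_zero.1 hw], ?_⟩
        rw [hτ0, h.1]
        simp [cnt]
      | succ x ih =>
        by_cases hx' : x ∈ B
        · obtain ⟨L, h1, h2, h3⟩ := ih hx'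
          refine ⟨L, by omega, fun w h4 h5 => ?_, by rw [hτB x hx', h3]⟩
          rcases h5.eq_or_lt with rfl | h5
          · exact hx
          · exact h2 w h4 (by omega)
        · exact ⟨x + 1, le_rfl, fun w h4 h5 => by rwa [le_antisymm h5 h4], hτB' x hx'⟩
    -- An increasing stretch inside `B` cannot contain group `j` from its first star letter to its
    -- last: the position of the first one would belong to `X j`.
    have hfull : ∀ y m j s', a (y + m) = a y + m → (∀ w, y ≤ w → w ≤ y + m → w ∈ B) →
        cnt (a y) ≤ j * T → S s' → s' ≤ a y + m → cnt s' = j * T + (T - 1) → False := by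
      intro y m j s' hm hB hy hs' hle hcs'
      obtain ⟨s, hss', hs, hcs⟩ := exists_count_eq (p := S) (i := j * T) (n := s')
        (by change _ < cnt s'; omega)
      have hys : a y ≤ s := by
        by_contra hlt
        have := hstrict hs (not_le.1 hlt)
        have hcs : cnt s = j * T := hcs
        omega
      have h1 : a (y + (s - a y)) = s := by
        rw [h.add_of_le hm (by omega)]; omega
      refine (hB (y + (s - a y)) (by omega) (by omega)).2 j
        ⟨by rwa [h1], by rw [h1]; exact hcs, s' - s, ?_, ?_, ?_, ?_⟩
      · rw [h1, add_assoc, h.add_of_le hm (by omega)]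
        omega
      · rwa [h1, Nat.add_sub_cancel' hss'.le]
      · rwa [h1, Nat.add_sub_cancel' hss'.le]
      · exact fun i hi => (hB _ (by omega) (by omega)).1
    -- The case `l = a x` locates the star attached to `p_x`; the case `l = a x + 1` locates a
    -- removed vertex just after the interval.
    have hkey : ∀ x ∈ B, ∀ l, S l → a x ≤ l → l ≤ a x + 1 →
        cnt l / T = 0 ∨ cnt l / T = τ x ∨ cnt l / T = τ x + 1 := by
      intro x hx l hl h1 h2
      obtain ⟨L, hL, hLB, hτx⟩ := hleft x hx
      rcases Nat.eq_zero_or_pos (cnt l / T) with h0 | h0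
      · exact Or.inl h0
      right
      obtain ⟨i, hi⟩ : ∃ i, cnt l / T = i + 1 := ⟨cnt l / T - 1, by omega⟩
      have hil : i * T + T ≤ cnt l := by
        have := Nat.div_mul_le_self (cnt l) T
        rw [hi] at this
        linarith [Nat.succ_mul i T]
      -- Here `x - a x` is where the run of `x` starts. If this is not after `L`, letters increase
      -- from `L` to `x` and group `i` is not traversed, so `L` lies in group `i` or `i + 1`.
      -- Otherwise the run starts at letter `0` inside the interval and cannot complete group `0`.
      by_cases hrun : x - a x ≤ L
      · have h3 := h.sub (x := x) (i := x - L) (by omega)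
        rw [show x - (x - L) = L by omega] at h3
        have h4 : ¬ cnt (a L) ≤ i * T := by
          intro hle
          obtain ⟨s', hs'l, hs', hcs'⟩ := exists_count_eq (p := S) (i := i * T + (T - 1)) (n := l)
            (by change _ < cnt l; omega)
          exact hfull L (x - L) i s' (by rw [Nat.add_sub_cancel' hL, h3])
            (fun w h5 h6 => hLB w h5 (by omega)) hle hs' (by omega) hcs'
        have h5 : i ≤ cnt (a L) / T := by
          rw [Nat.le_div_iff_mul_le (by omega)]
          omega
        have h6 : cnt (a L) / T ≤ cnt l / T := Nat.div_le_div_right (hmono (by omega))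
        omega
      · exfalso
        have h3 := h.sub (x := x) (i := a x) le_rfl
        have h4 := h.le_self x
        obtain ⟨s', hs'l, hs', hcs'⟩ := exists_count_eq (p := S) (i := T - 1) (n := l)
          (by change _ < cnt l; omega)
        have h5 : a (x - a x) = 0 := by omega
        refine hfull (x - a x) (a x) 0 s' ?_ (fun w h6 h7 => hLB w (by omega) (by omega)) ?_ hs'
          (by omega) (by change cnt s' = T - 1 at hcs'; omega)
        · rw [Nat.sub_add_cancel h4, h5, zero_add]
        · rw [h5]; simp [cnt]
    let Y : ℕ → Set (ℕ ⊕ ℕ) := fun j =>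
      Sum.inr '' {s | S s ∧ j * T ≤ cnt s ∧ cnt s < j * T + T} ∪ Sum.inl '' X j
    have hY : ∀ j, (Y j).encard ≤ (2 * T : ℕ) := fun j => by
      refine (Set.encard_union_le _ _).trans ?_
      rw [Sum.inr_injective.encard_image, Sum.inl_injective.encard_image, two_mul]
      push_cast
      exact add_le_add (encard_setOf_count_le (p := S) (j * T) T) (hX j)
    have hstarY : ∀ s, S s → .inr s ∈ Y (cnt s / T) := fun s hs => by
      refine Or.inl ⟨s, ⟨hs, Nat.div_mul_le_self _ _, ?_⟩, rfl⟩
      exact Nat.lt_div_mul_add (by omega)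
    have hXj : ∀ x, x ∉ B → .inl x ∈ U → ∃ j, x ∈ X j := fun x hx hxU => by
      by_contra hcon
      push Not at hcon
      exact hx ⟨hxU, hcon⟩
    let level : ℕ ⊕ ℕ → ℕ := Sum.elim (fun x => cnt (a x) / T) fun s => cnt s / T
    have hlevel : ∀ v j, v ∈ Y j → level v = j := by
      rintro v j (⟨s, ⟨-, h1, h2⟩, rfl⟩ | ⟨x, ⟨-, h1, -⟩, rfl⟩)
      · exact Nat.div_eq_of_lt_le h1 (by rwa [Nat.succ_mul])
      · change cnt (a x) / T = j
        rw [h1, Nat.mul_div_cancel _ (by omega)]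
    have hXsucc : ∀ x j, x ∈ X j → a (x + 1) = a x + 1 ∧ cnt (a (x + 1)) = j * T + 1 := by
      rintro x j ⟨h1, h2, m, h3, -, h4, -⟩
      have hm : m ≠ 0 := by
        rintro rfl
        rw [add_zero] at h4
        omega
      have h5 := h.add_of_le h3 (i := 1) (by omega)
      exact ⟨h5, by rw [h5, hsucc h1, h2]⟩
    -- A vertex of level `j > 0` lies in exactly the bags `j - 1` and `j`, and one of level `0` in
    -- all; in both cases the first bag is the truncated `level v - 1`.
    let β : ℕ → Set (ℕ ⊕ ℕ) := fun n => (({.inr 0} ∪ Y 0) ∪ Y n) ∪ Y (n + 1)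
    have hβ : ∀ v j n, v ∈ Y j → j = 0 ∨ j = n ∨ j = n + 1 → v ∈ β n := by
      rintro v j n hv (rfl | rfl | rfl)
      · exact Or.inl (Or.inl (Or.inr hv))
      · exact Or.inl (Or.inr hv)
      · exact Or.inr hv
    refine exists_rootedDecomposition e B τ β (fun v => level v - 1) ?_ ?_ ?_ ?_ ?_ ?_ ?_ ?_ ?_
    · intro n
      refine (Set.encard_union_le _ _).trans ?_
      push_cast
      refine add_le_add ?_ (by exact_mod_cast hY _)
      refine (Set.encard_union_le _ _).trans ?_
      refine add_le_add ?_ (by exact_mod_cast hY _)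
      refine (Set.encard_union_le _ _).trans ?_
      exact add_le_add (Set.encard_singleton _).le (by exact_mod_cast hY _)
    · rintro (x | s) hv hB
      · obtain ⟨j, hj⟩ := hXj x (fun hx => hB x hx rfl) hv
        have h1 : Sum.inl x ∈ Y j := Or.inr ⟨x, hj, rfl⟩
        refine hβ _ j _ h1 ?_
        rw [hlevel _ j h1]
        omega
      · rcases Nat.eq_zero_or_pos s with rfl | hs
        · exact Or.inl (Or.inl (Or.inl rfl))
        · refine hβ _ _ _ (hstarY s ⟨hv, hs⟩) ?_
          change cnt s / T = 0 ∨ cnt s / T = cnt s / T - 1 ∨ cnt s / T = cnt s / T - 1 + 1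
          generalize cnt s / T = q
          omega
    · have hnode : ∀ v j n, v ∈ Y j → j = 0 ∨ j = n ∨ j = n + 1 → n ≠ level v - 1 →
          0 < n ∧ v ∈ β (n - 1) := by
        intro v j n hv hj hn
        rw [hlevel v j hv] at hn
        exact ⟨by omega, hβ v j _ hv (by omega)⟩
      rintro v n (((hv | hv) | hv) | hv) hn
      · obtain rfl : v = .inr 0 := hv
        have h1 : level (.inr 0) = 0 := by simp [level, cnt]
        rw [h1] at hn
        exact ⟨by omega, Or.inl (Or.inl (Or.inl rfl))⟩
      · exact hnode v 0 n hv (Or.inl rfl) hn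
      · exact hnode v n n hv (Or.inr (Or.inl rfl)) hn
      · exact hnode v (n + 1) n hv (Or.inr (Or.inr rfl)) hn
    · intro x hx hxU hs
      obtain ⟨j, hj⟩ := hXj x hx hxU
      refine ⟨j, hβ _ j j (Or.inr ⟨x, hj, rfl⟩) (Or.inr (Or.inl rfl)),
        hβ _ j j (Or.inl ⟨a x, ⟨hj.1, hj.2.1.ge, ?_⟩, rfl⟩) (Or.inr (Or.inl rfl))⟩
      have := hj.2.1
      omega
    · intro x hx hx' hxU hxU'
      obtain ⟨j, hj⟩ := hXj x hx hxU
      obtain ⟨j', hj'⟩ := hXj _ hx' hxU'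
      exfalso
      have h1 := (hXsucc x j hj).2.symm.trans hj'.2.1
      have h2 : (j * T + 1) % T = 1 := by
        rw [mul_comm, Nat.mul_add_mod, Nat.mod_eq_of_lt hT2]
      rw [h1, Nat.mul_mod_left] at h2
      omega
    · intro x hx _
      exact hτB x hx
    · intro x hx hs
      rcases Nat.eq_zero_or_pos (a x) with h0 | h0
      · rw [h0]; exact Or.inl (Or.inl (Or.inl rfl))
      · exact hβ _ _ _ (hstarY _ ⟨hs, h0⟩) (hkey x hx _ ⟨hs, h0⟩ le_rfl (by omega))
    · intro x hx hx' hU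
      obtain ⟨j, hj⟩ := hXj _ hx' hU
      have h1 : a (x + 1) = a x + 1 := by
        have := hj.1.2
        rcases h.2 x with h | h <;> omega
      have h2 := hkey x hx _ hj.1 (by omega) (by omega)
      rw [hj.2.1, Nat.mul_div_cancel _ (by omega)] at h2
      exact hβ _ j _ (Or.inr ⟨_, hj, rfl⟩) h2
    · intro x hx hx' hU
      obtain ⟨j, hj⟩ := hXj _ hx hU
      refine hβ _ j _ (Or.inr ⟨_, hj, rfl⟩) ?_
      rw [hτB' x hx, (hXsucc x j hj).2, Nat.div_eq_of_lt_le (k := j) (by omega)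
        (by rw [Nat.succ_mul]; omega)]
      exact Or.inr (Or.inl rfl)

end IsSawtooth

end Sawtooth

/-! ### Degrees and connected sets in subdivisions -/

section SubdivisionLemmas

variable {A V : Type} {Γ : SimpleGraph A} {G : SimpleGraph V}

namespace Subdivision

theorem not_mem_range_branch (h : Subdivision Γ G) {u v : A} (huv : Γ.Adj u v) {i : ℕ}
    (hi : i ≠ 0) (hi' : i < (h.path u v huv).length) :
    (h.path u v huv).getVert i ∉ Set.range h.branch := by
  rintro ⟨w, hw⟩
  have hinj := (h.isPath u v huv).getVert_injOn
  have hmem : h.branch w ∈ (h.path u v huv).support := hw ▸ SimpleGraph.Walk.getVert_mem_support _ _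
  rcases h.branch_mem u v huv w hmem with rfl | rfl
  · have h1 := hinj (x₁ := i) (x₂ := 0) hi'.le (Nat.zero_le _) (by simp [← hw])
    exact hi h1
  · have h1 := hinj (x₁ := i) (x₂ := (h.path u w huv).length) hi'.le (le_refl (h.path u w huv).length) (by simp [← hw])
    omega

/-- The neighbours of an inner vertex of a subdivided edge are its neighbours on that edge. -/
theorem eq_or_eq_of_adj_getVert (h : Subdivision Γ G) {u v : A} (huv : Γ.Adj u v) {i : ℕ}
    (hi : i ≠ 0) (hi' : i < (h.path u v huv).length) {z : V}
    (hz : G.Adj ((h.path u v huv).getVert i) z) :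
    z = (h.path u v huv).getVert (i - 1) ∨ z = (h.path u v huv).getVert (i + 1) := by
  obtain ⟨u', v', huv', hmem⟩ := h.edge_mem _ _ hz
  have hsymm : s(u, v) = s(u', v') := by
    by_contra hne
    exact h.not_mem_range_branch huv hi hi' (h.disjoint u v huv u' v' huv' hne _
      (SimpleGraph.Walk.getVert_mem_support _ _)
      (SimpleGraph.Walk.fst_mem_support_of_mem_edges _ hmem))
  have hmem' : s((h.path u v huv).getVert i, z) ∈ (h.path u v huv).edges := by
    rw [Sym2.eq_iff] at hsymm
    rcases hsymm with ⟨rfl, rfl⟩ | ⟨rfl, rfl⟩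
    · exact hmem
    · rw [h.path_symm u v huv] at hmem
      simpa using hmem
  have hz' : z ∈ (h.path u v huv).toSubgraph.neighborSet ((h.path u v huv).getVert i) := by
    rw [SimpleGraph.Subgraph.mem_neighborSet, ← SimpleGraph.Subgraph.mem_edgeSet,
      SimpleGraph.Walk.mem_edges_toSubgraph]
    exact hmem'
  rw [(h.isPath u v huv).neighborSet_toSubgraph_internal hi hi'] at hz'
  simpa using hz'

theorem exists_eq_snd_of_adj_branch (h : Subdivision Γ G) {w : A} {y : V}
    (hy : G.Adj (h.branch w) y) : ∃ v, ∃ hv : Γ.Adj w v, (h.path w v hv).snd = y := by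
  obtain ⟨u, v, huv, hmem⟩ := h.edge_mem _ _ hy
  have key : ∀ v (hv : Γ.Adj w v), s(h.branch w, y) ∈ (h.path w v hv).edges →
      (h.path w v hv).snd = y := fun v hv hm => by
    refine (h.isPath w v hv).snd_of_toSubgraph_adj ?_
    rwa [← SimpleGraph.Subgraph.mem_edgeSet, SimpleGraph.Walk.mem_edges_toSubgraph]
  rcases h.branch_mem u v huv w (SimpleGraph.Walk.fst_mem_support_of_mem_edges _ hmem) with rfl | rfl
  · exact ⟨v, huv, key v huv hmem⟩
  · refine ⟨u, huv.symm, key u huv.symm ?_⟩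
    rw [h.path_symm u w huv]
    simpa using hmem

theorem path_not_nil (h : Subdivision Γ G) {u v : A} (huv : Γ.Adj u v) :
    ¬ (h.path u v huv).Nil := fun hn =>
  huv.ne (h.branch_injective hn.eq)

theorem eq_of_mem_support (h : Subdivision Γ G) {w v v' : A} (hv : Γ.Adj w v) (hv' : Γ.Adj w v')
    {x : V} (hx : x ∈ (h.path w v hv).support) (hx' : x ∈ (h.path w v' hv').support)
    (hxw : x ≠ h.branch w) : v = v' := by
  by_contra hne
  have hs : s(w, v) ≠ s(w, v') := fun hs => hne (Sym2.congr_right.1 hs)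
  obtain ⟨z, rfl⟩ := h.disjoint w v hv w v' hv' hs x hx hx'
  rcases h.branch_mem w v hv z hx with rfl | rfl
  · exact hxw rfl
  · rcases h.branch_mem w v' hv' z hx' with rfl | rfl
    · exact hxw rfl
    · exact hne rfl

theorem snd_ne (h : Subdivision Γ G) {w v : A} (hv : Γ.Adj w v) :
    (h.path w v hv).snd ≠ h.branch w :=
  ((h.path w v hv).adj_snd (h.path_not_nil hv)).ne'

theorem snd_inj (h : Subdivision Γ G) {w v v' : A} (hv : Γ.Adj w v) (hv' : Γ.Adj w v')
    (heq : (h.path w v hv).snd = (h.path w v' hv').snd) : v = v' :=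
  h.eq_of_mem_support hv hv' (SimpleGraph.Walk.getVert_mem_support _ 1)
    (by change (h.path w v hv).snd ∈ _; rw [heq]; exact SimpleGraph.Walk.getVert_mem_support _ 1)
    (h.snd_ne hv)

theorem encard_neighborSet_le (h : Subdivision Γ G) {k : ℕ∞} (hk : 2 ≤ k)
    (hΓ : ∀ w, (Γ.neighborSet w).encard ≤ k) (x : V) : (G.neighborSet x).encard ≤ k := by
  classical
  have key : ∀ w, (G.neighborSet (h.branch w)).encard ≤ k := by
    intro w
    refine le_trans ?_ (hΓ w)
    refine le_trans ?_ (Set.encard_image_le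
      (fun v => if hv : Γ.Adj w v then (h.path w v hv).snd else h.branch w) _)
    refine Set.encard_le_encard fun y hy => ?_
    obtain ⟨v, hv, rfl⟩ := h.exists_eq_snd_of_adj_branch hy
    exact ⟨v, hv, dif_pos hv⟩
  by_cases hx : x ∈ Set.range h.branch
  · obtain ⟨w, rfl⟩ := hx
    exact key w
  · obtain ⟨u, v, huv, hmem⟩ := (h.vertex_mem x).resolve_left hx
    obtain ⟨i, rfl, hi⟩ := SimpleGraph.Walk.mem_support_iff_exists_getVert.1 hmem
    have hi0 : i ≠ 0 := by
      rintro rfl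
      exact hx ⟨u, by simp⟩
    have hil : i < (h.path u v huv).length := by
      refine lt_of_le_of_ne hi ?_
      rintro rfl
      exact hx ⟨v, by simp⟩
    refine le_trans (le_trans (Set.encard_le_encard (t := {(h.path u v huv).getVert (i - 1),
      (h.path u v huv).getVert (i + 1)}) fun z hz => ?_) (Set.encard_insert_le _ _)) (le_trans ?_ hk)
    · simpa using h.eq_or_eq_of_adj_getVert huv hi0 hil hz
    · rw [Set.encard_singleton]; norm_num

/-- The vertices of the subdivision that belong to the subgraph induced by `Q`. -/
def lift (h : Subdivision Γ G) (Q : Set A) : Set V :=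
  {x | (∃ w ∈ Q, h.branch w = x) ∨ ∃ u ∈ Q, ∃ v ∈ Q, ∃ huv : Γ.Adj u v, x ∈ (h.path u v huv).support}

theorem isWalkConnected_lift (h : Subdivision Γ G) {Q : Set A} (hQ : IsWalkConnected Γ Q) :
    IsWalkConnected G (h.lift Q) := by
  classical
  have hwalk : ∀ {u v : A} (p : Γ.Walk u v), (∀ z ∈ p.support, z ∈ Q) →
      WalkIn G (h.lift Q) (h.branch u) (h.branch v) := by
    intro u v p
    induction p with
    | nil =>
      intro hp
      exact .refl (Or.inl ⟨_, hp _ (by simp), rfl⟩)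
    | cons huv p ih =>
      rename_i u v w
      intro hp
      refine .trans ⟨h.path u v huv, fun z hz => Or.inr ⟨u, hp u (by simp), v, hp v (by simp), huv, hz⟩⟩
        (ih fun z hz => hp z (by simp [hz]))
  have hend : ∀ x ∈ h.lift Q, ∃ w ∈ Q, WalkIn G (h.lift Q) (h.branch w) x := by
    rintro x (⟨w, hw, rfl⟩ | ⟨u, hu, v, hv, huv, hx⟩)
    · exact ⟨w, hw, .refl (Or.inl ⟨w, hw, rfl⟩)⟩
    · exact ⟨u, hu, (h.path u v huv).takeUntil x hx, fun z hz =>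
        Or.inr ⟨u, hu, v, hv, huv, SimpleGraph.Walk.support_takeUntil_subset_support _ hx hz⟩⟩
  intro x hx y hy
  obtain ⟨w, hw, hwx⟩ := hend x hx
  obtain ⟨w', hw', hwy⟩ := hend y hy
  obtain ⟨p, hp⟩ := hQ w hw w' hw'
  exact (hwx.symm.trans (hwalk p hp)).trans hwy

theorem disjoint_lift (h : Subdivision Γ G) {Q Q' : Set A} (hQ : Disjoint Q Q') :
    Disjoint (h.lift Q) (h.lift Q') := by
  rw [Set.disjoint_left] at hQ ⊢
  have key : ∀ {R : Set A} {w : A}, h.branch w ∈ h.lift R → w ∈ R := by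
    rintro R w (⟨w', hw', hww⟩ | ⟨u, hu, v, hv, huv, hx⟩)
    · exact h.branch_injective hww ▸ hw'
    · rcases h.branch_mem u v huv w hx with rfl | rfl
      · exact hu
      · exact hv
  intro x hx hx'
  by_cases hxb : x ∈ Set.range h.branch
  · obtain ⟨w, rfl⟩ := hxb
    exact hQ (key hx) (key hx')
  · rcases hx with ⟨w, -, rfl⟩ | ⟨u, hu, v, hv, huv, hx⟩
    · exact hxb ⟨w, rfl⟩
    rcases hx' with ⟨w, -, rfl⟩ | ⟨u', hu', v', hv', huv', hx'⟩
    · exact hxb ⟨w, rfl⟩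
    refine hxb (h.disjoint u v huv u' v' huv' (fun heq => ?_) x hx hx')
    rw [Sym2.eq_iff] at heq
    rcases heq with ⟨rfl, rfl⟩ | ⟨rfl, rfl⟩
    · exact hQ hu hu'
    · exact hQ hu hv'

end Subdivision

theorem le_of_injective_of_encard_le {X : Type} {n k : ℕ} {f : Fin n → X}
    (hf : Function.Injective f) {W : Set X} (hW : ∀ i, f i ∈ W) (hk : W.encard ≤ k) : n ≤ k := by
  have h1 : (Set.range f).encard = n := by
    rw [← Set.image_univ, hf.encard_image, Set.encard_univ]
    simp
  have h2 := (Set.encard_le_encard (Set.range_subset_iff.2 hW)).trans hk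
  rw [h1] at h2
  exact_mod_cast h2

end SubdivisionLemmas

/-! ### Subdivisions with many vertices of large degree -/

section HighDegree

variable {A V : Type} {Γ : SimpleGraph A} {G : SimpleGraph V} {a : ℕ → ℕ}

/-- A discrete intermediate value theorem, needed because the direction in which a path runs through
the positions is not known. -/
theorem exists_eq_of_unit_steps {q : ℕ → ℕ} {n : ℕ}
    (hq : ∀ i, 1 ≤ i → i < n → q (i + 1) = q i + 1 ∨ q i = q (i + 1) + 1) (hn : 1 ≤ n) {y : ℕ}
    (hy : q 1 ≤ y ∧ y ≤ q n ∨ q n ≤ y ∧ y ≤ q 1) : ∃ i, 1 ≤ i ∧ i ≤ n ∧ q i = y := by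
  induction n, hn using Nat.le_induction with
  | base => exact ⟨1, le_rfl, le_rfl, by omega⟩
  | succ n hn ih =>
    by_cases hy' : y = q (n + 1)
    · exact ⟨n + 1, by omega, le_rfl, hy'.symm⟩
    · have h1 := hq n hn (by omega)
      obtain ⟨i, h2, h3, h4⟩ := ih (fun i h2 h3 => hq i h2 (by omega)) (by omega)
      exact ⟨i, h2, by omega, h4⟩

/-- On a path between two stars whose inner vertices have no further neighbours, the first star
after the start is linked to the start. -/
theorem exists_linked_of_isPath (e : G ↪g starPath a) {x y : V} {s s' : ℕ} (p : G.Walk x y)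
    (hp : p.IsPath) (hxy : x ≠ y) (hx : e x = .inr s) (hy : e y = .inr s')
    (hnbr : ∀ i, i ≠ 0 → i < p.length → ∀ z, G.Adj (p.getVert i) z →
      z = p.getVert (i - 1) ∨ z = p.getVert (i + 1)) :
    ∃ u, ∃ z ∈ p.support, z ≠ x ∧ e z = .inr u ∧ Linked a {s | .inr s ∈ Set.range e} s u := by
  classical
  have hlen : p.length ≠ 0 := fun h => hxy (SimpleGraph.Walk.eq_of_length_eq_zero h)
  have hex : ∃ m, 1 ≤ m ∧ m ≤ p.length ∧ ∃ u, e (p.getVert m) = .inr u :=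
    ⟨p.length, by omega, le_rfl, s', by simpa using hy⟩
  obtain ⟨hm1, hml, u, hu⟩ := Nat.find_spec hex
  have hmin := fun {m'} => Nat.find_min (m := m') hex
  generalize Nat.find hex = m at hm1 hml hu hmin
  have hinj : ∀ {i j}, i ≤ p.length → j ≤ p.length → p.getVert i = p.getVert j → i = j :=
    fun hi hj h => hp.getVert_injOn hi hj h
  -- The position of the `i`-th vertex; the value `0` at stars is junk and is not used for `1 ≤ i <
  -- m`, where `m` is the index of the first star after the start.
  let q : ℕ → ℕ := fun i => Sum.elim id (fun _ => 0) (e (p.getVert i))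
  have hq : ∀ i, 1 ≤ i → i < m → e (p.getVert i) = .inl (q i) := by
    intro i hi him
    rcases hi' : e (p.getVert i) with z | u'
    · simp [q, hi']
    · exact absurd ⟨hi, by omega, u', hi'⟩ (hmin him)
  have hadj : ∀ i, i < p.length → (starPath a).Adj (e (p.getVert i)) (e (p.getVert (i + 1))) :=
    fun i hi => e.map_rel_iff.2 (p.adj_getVert_succ hi)
  have h0 : e (p.getVert 0) = .inr s := by simpa using hx
  have hm1' : m ≠ 1 := by
    rintro rfl
    have := hadj 0 (by omega)
    rw [h0, hu] at this
    exact this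
  have hs : a (q 1) = s := by
    have := hadj 0 (by omega)
    rw [h0, hq 1 le_rfl (by omega)] at this
    exact this
  have hau : a (q (m - 1)) = u := by
    have := hadj (m - 1) (by omega)
    rw [Nat.sub_add_cancel hm1, hu, hq (m - 1) (by omega) (by omega)] at this
    exact this
  have hm2 : m ≠ 2 := by
    rintro rfl
    have h1 : e (p.getVert 2) = e (p.getVert 0) := by
      rw [hu, h0, ← hs, ← hau]
    have := hinj hml (by omega) (e.injective h1)
    omega
  have hstep : ∀ i, 1 ≤ i → i < m - 1 → q (i + 1) = q i + 1 ∨ q i = q (i + 1) + 1 := by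
    intro i h1 h2
    have := hadj i (by omega)
    rw [hq i h1 (by omega), hq (i + 1) (by omega) (by omega)] at this
    exact this
  have hne : q 1 ≠ q (m - 1) := by
    intro h
    have h1 := hq 1 le_rfl (by omega)
    rw [h, ← hq (m - 1) (by omega) (by omega)] at h1
    have := hinj (by omega) (by omega) (e.injective h1)
    omega
  -- Each such position is an inner vertex of the path whose two path neighbours are both path
  -- vertices; an attached star of the graph would be a third neighbour.
  have hint : ∀ w, q 1 < w ∧ w < q (m - 1) ∨ q (m - 1) < w ∧ w < q 1 →
      a w ∉ {s | .inr s ∈ Set.range e} := by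
    rintro w hw ⟨z, hz⟩
    obtain ⟨i, hi1, him, rfl⟩ := exists_eq_of_unit_steps hstep (by omega) (y := w) (by omega)
    have hi1' : i ≠ 1 := by rintro rfl; omega
    have him' : i ≠ m - 1 := by rintro rfl; omega
    have hz' : G.Adj (p.getVert i) z := by
      refine e.map_rel_iff.1 ?_
      change (starPath a).Adj (e (p.getVert i)) (e z)
      rw [hq i hi1 (by omega), hz]
      exact rfl
    rcases hnbr i (by omega) (by omega) z hz' with rfl | rfl
    · rw [hq (i - 1) (by omega) (by omega)] at hz
      cases hz
    · rw [hq (i + 1) (by omega) (by omega)] at hz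
      cases hz
  refine ⟨u, p.getVert m, p.getVert_mem_support m, fun h => ?_, hu, ?_⟩
  · have := hinj (i := m) (j := 0) hml (by omega) (by simpa using h)
    omega
  · rcases lt_or_gt_of_ne hne with hlt | hlt
    · exact ⟨q 1, q (m - 1), hlt, Or.inl ⟨hs, hau⟩, fun w h1 h2 => hint w (Or.inl ⟨h1, h2⟩)⟩
    · exact ⟨q (m - 1), q 1, hlt, Or.inr ⟨hau, hs⟩, fun w h1 h2 => hint w (Or.inr ⟨h1, h2⟩)⟩

/-- All branch vertices have degree above three, so they are stars, and among `c + 1` of them one is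
not exceptional. Its more than `D` subdivided edges meet only at that star, so their first stars are
distinct letters linked to it. -/
theorem not_isSubdivision_of_linkBound {c D : ℕ} (hL : LinkBound a c D) (e : G ↪g starPath a)
    {b : Fin (c + 1) → A} (hb : Function.Injective b)
    (hdeg : ∀ w, ∃ f : Fin (max D 3 + 1) → A, Function.Injective f ∧ ∀ i, Γ.Adj w (f i)) :
    ¬ IsSubdivision Γ G := by
  rintro ⟨h⟩
  have hstar : ∀ w, ∃ s, e (h.branch w) = .inr s := by
    intro w
    rcases hw : e (h.branch w) with x | s
    · exfalso
      obtain ⟨f, hf, hadj⟩ := hdeg w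
      have hinj : Function.Injective fun i => e (h.path w (f i) (hadj i)).snd := fun i j hij =>
        hf (h.snd_inj _ _ (e.injective hij))
      have := le_of_injective_of_encard_le (k := 3) hinj
        (W := {.inl (x + 1), .inl (x - 1), .inr (a x)}) (fun i => ?_) ?_
      · omega
      · have h1 := e.map_rel_iff.2 ((h.path w (f i) (hadj i)).adj_snd (h.path_not_nil _))
        change (starPath a).Adj (e (h.branch w)) (e (h.path w (f i) (hadj i)).snd) at h1
        rw [hw] at h1
        rcases hy : e (h.path w (f i) (hadj i)).snd with y | s <;> rw [hy] at h1
        · rcases h1 with h1 | h1 <;> simp [h1]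
        · have h1 : a x = s := h1
          simp [h1]
      · refine (Set.encard_insert_le _ _).trans ?_
        refine (add_le_add_left (Set.encard_insert_le _ _) 1).trans ?_
        rw [Set.encard_singleton]
        norm_num
    · exact ⟨s, rfl⟩
  choose σ hσ using hstar
  have hσinj : Function.Injective σ := fun w w' hw =>
    h.branch_injective (e.injective (by rw [hσ, hσ, hw]))
  obtain ⟨C, hC, hlink⟩ := hL {s | .inr s ∈ Set.range e}
  obtain ⟨i, hi⟩ : ∃ i, σ (b i) ∉ C := by
    by_contra hcon
    push Not at hcon
    have := le_of_injective_of_encard_le (hσinj.comp hb) hcon hC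
    omega
  obtain ⟨f, hf, hadj⟩ := hdeg (b i)
  have hex : ∀ j, ∃ u, ∃ z ∈ (h.path (b i) (f j) (hadj j)).support, z ≠ h.branch (b i) ∧
      e z = .inr u ∧ Linked a {s | .inr s ∈ Set.range e} (σ (b i)) u := fun j =>
    exists_linked_of_isPath e _ (h.isPath _ _ _) (h.branch_injective.ne (hadj j).ne) (hσ _) (hσ _)
      fun k hk hk' z hz => h.eq_or_eq_of_adj_getVert (hadj j) hk hk' hz
  choose u z hzs hzne hzu hu using hex
  have huinj : Function.Injective u := fun j j' hj => by
    have h1 : z j = z j' := e.injective (by rw [hzu, hzu, hj])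
    exact hf (h.eq_of_mem_support (hadj j) (hadj j') (hzs j) (h1 ▸ hzs j') (hzne j))
  have := le_of_injective_of_encard_le huinj (fun j => ?_)
    (hlink (σ (b i)) ⟨h.branch (b i), hσ _⟩ hi)
  · omega
  · exact ⟨⟨z j, hzu j⟩, fun hne => hzne j (e.injective (by rw [hzu, hne, hσ])), hu j⟩

end HighDegree

/-! ### Walls: tree-width and degrees -/

section Walls

variable {t : ℕ}

theorem mem_wallVertices_of_inner {x y : ℕ} (hx : x ≤ 2 * t + 1) (hy : 1 ≤ y) (hy' : y < t) :
    (x, y) ∈ wallVertices t t :=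
  ⟨hx, hy'.le, fun h => by omega, fun h => by omega⟩

theorem wall_adj_right {x y : ℕ} (h : (x, y) ∈ wallVertices t t)
    (h' : (x + 1, y) ∈ wallVertices t t) : (wall t t).Adj ⟨(x, y), h⟩ ⟨(x + 1, y), h'⟩ := by
  rw [wall, SimpleGraph.fromRel_adj]
  exact ⟨fun he => by simp at he, Or.inl (Or.inl ⟨rfl, rfl⟩)⟩

theorem wall_adj_up {x y : ℕ} (h : (x, y) ∈ wallVertices t t)
    (h' : (x, y + 1) ∈ wallVertices t t) (he : Even (x + y)) :
    (wall t t).Adj ⟨(x, y), h⟩ ⟨(x, y + 1), h'⟩ := by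
  rw [wall, SimpleGraph.fromRel_adj]
  exact ⟨fun he => by simp at he, Or.inl (Or.inr (Or.inr ⟨rfl, rfl, he⟩))⟩

/-- The horizontal line at height `y`. -/
def wallRow (t y : ℕ) : Set (wallVertices t t) := {p | p.1.2 = y}

/-- The vertical zigzag path with abscissae `2 c` and `2 c + 1`, without its ends. -/
def wallColumn (t c : ℕ) : Set (wallVertices t t) :=
  {p | (p.1.1 = 2 * c ∨ p.1.1 = 2 * c + 1) ∧ 1 ≤ p.1.2 ∧ p.1.2 < t}

theorem isWalkConnected_wallRow {y : ℕ} (hy : 1 ≤ y) (hy' : y < t) :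
    IsWalkConnected (wall t t) (wallRow t y) := by
  refine .of_base (x := ⟨(0, y), mem_wallVertices_of_inner (by omega) hy hy'⟩) ?_
  have key : ∀ x (hx : x ≤ 2 * t + 1), WalkIn (wall t t) (wallRow t y)
      ⟨(0, y), mem_wallVertices_of_inner (by omega) hy hy'⟩
      ⟨(x, y), mem_wallVertices_of_inner hx hy hy'⟩ := by
    intro x
    induction x with
    | zero => exact fun _ => .refl rfl
    | succ x ih =>
      exact fun hx => (ih (by omega)).trans (.of_adj (wall_adj_right _ _) rfl rfl)
  rintro ⟨⟨x, y'⟩, hp⟩ (rfl : y' = y)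
  exact key x hp.1

theorem isWalkConnected_wallColumn {c : ℕ} (hc : c ≤ t) (ht : 2 ≤ t) :
    IsWalkConnected (wall t t) (wallColumn t c) := by
  have hmem : ∀ {x y}, (x = 2 * c ∨ x = 2 * c + 1) → 1 ≤ y → y < t → (x, y) ∈ wallVertices t t :=
    fun hx hy hy' => mem_wallVertices_of_inner (by omega) hy hy'
  refine .of_base (x := ⟨(2 * c, 1), hmem (Or.inl rfl) (by omega) (by omega)⟩) ?_
  have hstep : ∀ y (hy : 1 ≤ y) (hy' : y < t), WalkIn (wall t t) (wallColumn t c)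
      ⟨(2 * c, y), hmem (Or.inl rfl) hy hy'⟩ ⟨(2 * c + 1, y), hmem (Or.inr rfl) hy hy'⟩ :=
    fun y hy hy' => .of_adj (wall_adj_right _ _) ⟨Or.inl rfl, hy, hy'⟩ ⟨Or.inr rfl, hy, hy'⟩
  have key : ∀ y (hy : 1 ≤ y) (hy' : y < t), WalkIn (wall t t) (wallColumn t c)
      ⟨(2 * c, 1), hmem (Or.inl rfl) (by omega) (by omega)⟩
      ⟨(2 * c, y), hmem (Or.inl rfl) hy hy'⟩ := by
    intro y hy
    induction y, hy using Nat.le_induction with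
    | base => exact fun h => .refl ⟨Or.inl rfl, le_rfl, h⟩
    | succ y hy ih =>
      intro hy'
      have hy1 : y < t := by omega
      have hy2 : 1 ≤ y + 1 := by omega
      refine (ih hy1).trans ?_
      rcases Nat.even_or_odd y with he | ho
      · exact .of_adj (wall_adj_up _ _ (by simp [he, parity_simps])) ⟨Or.inl rfl, hy, hy1⟩
          ⟨Or.inl rfl, hy2, hy'⟩
      · have he : Even (2 * c + 1 + y) := by
          rw [Nat.odd_iff] at ho
          rw [Nat.even_iff]
          omega
        exact (hstep y hy hy1).trans (.trans (.of_adj (wall_adj_up _ (hmem (Or.inr rfl) hy2 hy') he)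
          ⟨Or.inr rfl, hy, hy1⟩ ⟨Or.inr rfl, hy2, hy'⟩) (hstep (y + 1) hy2 hy').symm)
  rintro ⟨⟨x, y⟩, hp⟩ ⟨rfl | rfl, hy, hy'⟩
  · exact key y hy hy'
  · exact (key y hy hy').trans (hstep y hy hy')

/-- A subdivision of a large wall has no tree-decomposition of small width. -/
theorem Subdivision.lt_of_rootedDecomposition {V ι : Type} {G : SimpleGraph V}
    (h : Subdivision (wall t t) G) (D : RootedDecomposition G ι) {N : ℕ}
    (hN : ∀ i, (D.bag i).encard ≤ N) : t < N + 2 := by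
  by_contra ht
  let row : Fin (t - 1) → Set V := fun r => h.lift (wallRow t (r + 1))
  let col : Fin (t + 1) → Set V := fun c => h.lift (wallColumn t c)
  have hcross : ∀ r c, (row r ∩ col c).Nonempty := fun r c => by
    have hr := r.2
    have hc := c.2
    have hp : (2 * (c : ℕ), (r : ℕ) + 1) ∈ wallVertices t t :=
      mem_wallVertices_of_inner (by omega) (by omega) (by omega)
    exact ⟨h.branch ⟨_, hp⟩, Or.inl ⟨_, rfl, rfl⟩,
      Or.inl ⟨_, ⟨Or.inl rfl, by change 1 ≤ (r : ℕ) + 1; omega, by change (r : ℕ) + 1 < t; omega⟩, rfl⟩⟩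
  have hrow : ∀ r, IsWalkConnected G (row r) := fun r =>
    h.isWalkConnected_lift (isWalkConnected_wallRow (by omega) (by omega))
  have hcol : ∀ c, IsWalkConnected G (col c) := fun c =>
    h.isWalkConnected_lift (isWalkConnected_wallColumn (by omega) (by omega))
  -- Crosses are connected and any two meet, because the row of one meets the column of the other.
  -- By the Helly property some bag meets every cross.
  let T : Fin (t - 1) × Fin (t + 1) → Set ι := fun k => D.nodes (row k.1 ∪ col k.2)
  have : Nonempty (Fin (t - 1) × Fin (t + 1)) := ⟨⟨⟨0, by omega⟩, ⟨0, by omega⟩⟩⟩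
  obtain ⟨i, hi⟩ := exists_mem_of_pairwise_inter (T := T) (par := D.par) (rank := D.rank)
    (fun ⟨r, c⟩ => by
      obtain ⟨x, hx, hx'⟩ := hcross r c
      exact D.exists_top_nodes ⟨x, Or.inl hx⟩ ((hrow r).union (hcol c) hx hx'))
    (fun ⟨r, c⟩ ⟨r', c'⟩ => by
      obtain ⟨x, hx, hx'⟩ := hcross r c'
      exact ⟨D.top x, ⟨x, Or.inl hx, (D.bag_isSubtree x).1⟩, ⟨x, Or.inr hx', (D.bag_isSubtree x).1⟩⟩)
  have hdisj : ∀ {n : ℕ} {Q : Fin n → Set (wallVertices t t)},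
      (∀ j j', j ≠ j' → Disjoint (Q j) (Q j')) → (∀ j, ∃ x ∈ h.lift (Q j), x ∈ D.bag i) →
      n ≤ N := by
    intro n Q hQ hx
    choose f hf hfi using hx
    refine le_of_injective_of_encard_le (f := f) (fun j j' hj => ?_) hfi (hN i)
    by_contra hne
    exact Set.disjoint_left.1 (h.disjoint_lift (hQ j j' hne)) (hf j) (hj ▸ hf j')
  -- The bag meets all rows, or it misses one row and, through the crosses of that row, meets all
  -- columns. The rows are disjoint, and so are the columns.
  by_cases hall : ∀ r, ∃ x ∈ row r, x ∈ D.bag i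
  · have := hdisj (Q := fun r : Fin (t - 1) => wallRow t (r + 1)) (fun j j' hj => ?_) hall
    · omega
    · rw [Set.disjoint_left]
      intro p (hp : p.1.2 = j + 1) (hp' : p.1.2 = j' + 1)
      exact hj (Fin.ext (by omega))
  · push Not at hall
    obtain ⟨r, hr⟩ := hall
    have := hdisj (Q := fun c : Fin (t + 1) => wallColumn t c) (fun j j' hj => ?_) fun c => ?_
    · omega
    · rw [Set.disjoint_left]
      rintro p ⟨hp, -⟩ ⟨hp', -⟩
      exact hj (Fin.ext (by omega))
    · obtain ⟨x, hx | hx, hxi⟩ := hi (r, c)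
      · exact absurd hxi (hr x hx)
      · exact ⟨x, hx, hxi⟩

/-- There is at most one neighbour on each side: an edge of length two exists only over a missing
vertex, which excludes the shorter edge. The parity rule allows only one vertical neighbour. -/
theorem wall_encard_neighborSet_le (p : wallVertices t t) :
    ((wall t t).neighborSet p).encard ≤ 3 := by
  have hone : ∀ W : Set (wallVertices t t), (∀ u ∈ W, ∀ v ∈ W, u = v) → W.encard ≤ 1 :=
    fun W hW => by
      rw [Set.encard_le_one_iff]
      exact fun u v hu hv => hW u hu v hv
  have hsub : (wall t t).neighborSet p ⊆
      ({q | (wall t t).Adj p q ∧ q.1.1 < p.1.1} ∪ {q | (wall t t).Adj p q ∧ p.1.1 < q.1.1}) ∪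
        {q | (wall t t).Adj p q ∧ q.1.1 = p.1.1} := fun q hq => by
    rcases lt_trichotomy q.1.1 p.1.1 with h | h | h
    · exact Or.inl (Or.inl ⟨hq, h⟩)
    · exact Or.inr ⟨hq, h⟩
    · exact Or.inl (Or.inr ⟨hq, h⟩)
  have hext : ∀ u v : wallVertices t t, u.1.1 = v.1.1 → u.1.2 = v.1.2 → u = v := fun u v h h' =>
    Subtype.ext (Prod.ext h h')
  have hgap : ∀ {x y x' y'}, (x, y) ∉ wallVertices t t → x = x' → y = y' →
      (x', y') ∉ wallVertices t t := by
    rintro x y x' y' h rfl rfl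
    exact h
  refine (Set.encard_le_encard hsub).trans ((Set.encard_union_le _ _).trans ?_)
  refine (add_le_add ((Set.encard_union_le _ _).trans (add_le_add
    (hone _ ?_) (hone _ ?_))) (hone _ ?_)).trans (by norm_num)
  · rintro u ⟨hu, hup⟩ v ⟨hv, hvp⟩
    rw [wall, SimpleGraph.fromRel_adj] at hu hv
    by_cases huv : u.1.1 = v.1.1
    · exact hext u v huv (by omega)
    · exfalso
      rcases hu.2 with (h1 | h1 | h1) | (h1 | h1 | h1) <;>
        rcases hv.2 with (h2 | h2 | h2) | (h2 | h2 | h2) <;> try omega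
      · exact hgap h2.2.2 (x' := u.1.1) (y' := u.1.2) (by omega) (by omega) u.2
      · exact hgap h1.2.2 (x' := v.1.1) (y' := v.1.2) (by omega) (by omega) v.2
  · rintro u ⟨hu, hup⟩ v ⟨hv, hvp⟩
    rw [wall, SimpleGraph.fromRel_adj] at hu hv
    by_cases huv : u.1.1 = v.1.1
    · exact hext u v huv (by omega)
    · exfalso
      rcases hu.2 with (h1 | h1 | h1) | (h1 | h1 | h1) <;>
        rcases hv.2 with (h2 | h2 | h2) | (h2 | h2 | h2) <;> try omega
      · exact hgap h2.2.2 (x' := u.1.1) (y' := u.1.2) (by omega) (by omega) u.2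
      · exact hgap h1.2.2 (x' := v.1.1) (y' := v.1.2) (by omega) (by omega) v.2
  · rintro u ⟨hu, hup⟩ v ⟨hv, hvp⟩
    rw [wall, SimpleGraph.fromRel_adj] at hu hv
    refine hext u v (by omega) ?_
    simp only [Nat.even_iff] at hu hv
    rcases hu.2 with (h1 | h1 | h1) | (h1 | h1 | h1) <;>
      rcases hv.2 with (h2 | h2 | h2) | (h2 | h2 | h2) <;> omega

/-- Some vertex of a wall has three neighbours. -/
theorem exists_wall_degree (ht : 2 ≤ t) :
    ∃ w, ∃ f : Fin 3 → wallVertices t t, Function.Injective f ∧ ∀ i, (wall t t).Adj w (f i) := by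
  have h1 : (1, 1) ∈ wallVertices t t := mem_wallVertices_of_inner (by omega) (by omega) (by omega)
  have h2 : (2, 1) ∈ wallVertices t t := mem_wallVertices_of_inner (by omega) (by omega) (by omega)
  have h3 : (3, 1) ∈ wallVertices t t := mem_wallVertices_of_inner (by omega) (by omega) (by omega)
  have h0 : (2, 0) ∈ wallVertices t t := ⟨by simp only; omega, by simp, by simp, fun h => by
    simp only at h; omega⟩
  refine ⟨⟨_, h2⟩, ![⟨_, h1⟩, ⟨_, h3⟩, ⟨_, h0⟩], ?_, ?_⟩
  · intro i j
    fin_cases i <;> fin_cases j <;> simp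
  · intro i
    fin_cases i
    · exact (wall_adj_right h1 h2).symm
    · exact wall_adj_right h2 h3
    · exact (wall_adj_up h0 h2 (by decide)).symm

end Walls

/-! ### From the word properties to the theorem -/

section KKWFreeness

/-- Stars are pairwise non-adjacent and the path has no triangle, so a triangle would consist of one
star and two consecutive positions with the same letter. -/
theorem starPath_not_triangle {a : ℕ → ℕ} (ha : ∀ x, a x ≠ a (x + 1)) {p q r : ℕ ⊕ ℕ}
    (hpq : (starPath a).Adj p q) (hpr : (starPath a).Adj p r) (hqr : (starPath a).Adj q r) :
    False := by
  have key : ∀ x y s, (starPath a).Adj (.inl x) (.inl y) → a x = s → a y = s → False := by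
    rintro x y s (rfl | rfl) h1 h2
    · exact ha _ (h1.trans h2.symm)
    · exact ha _ (h2.trans h1.symm)
  rcases p with x | s <;> rcases q with y | s' <;> rcases r with z | s''
  · have h1 : y = x + 1 ∨ x = y + 1 := hpq
    have h2 : z = x + 1 ∨ x = z + 1 := hpr
    have h3 : z = y + 1 ∨ y = z + 1 := hqr
    omega
  · exact key x y s'' hpq hpr hqr
  · exact key x z s' hpr hpq hqr
  · exact hqr
  · exact key y z s hqr hpq hpr
  · exact hpr
  · exact hpq
  · exact hqr

/-- The line graph of a subdivision of a wall contains a triangle. -/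
theorem not_lineGraph_of_isSubdivision_wall {a : ℕ → ℕ} (ha : ∀ x, a x ≠ a (x + 1)) {V W : Type}
    {G : SimpleGraph V} {H : SimpleGraph W} (e : G ↪g starPath a) {t : ℕ} (ht : 2 ≤ t)
    (hH : IsSubdivision (wall t t) H) (φ : G ≃g H.lineGraph) : False := by
  obtain ⟨h⟩ := hH
  obtain ⟨w, f, hf, hadj⟩ := exists_wall_degree ht
  have hsnd : ∀ i, H.Adj (h.branch w) (h.path w (f i) (hadj i)).snd := fun i =>
    SimpleGraph.Walk.adj_snd (h.path_not_nil _)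
  let E : Fin 3 → H.edgeSet := fun i => ⟨s(h.branch w, (h.path w (f i) (hadj i)).snd), hsnd i⟩
  have hE : ∀ i j, i ≠ j → (starPath a).Adj (e (φ.symm (E i))) (e (φ.symm (E j))) := by
    intro i j hij
    refine e.map_rel_iff.2 (φ.symm.map_rel_iff.2 ?_)
    rw [SimpleGraph.lineGraph_adj_iff_exists]
    refine ⟨fun heq => hij (hf (h.snd_inj (hadj i) (hadj j) ?_)), h.branch w, by simp [E], by simp [E]⟩
    exact Sym2.congr_right.1 (congrArg Subtype.val heq)
  exact starPath_not_triangle ha (hE 0 1 (by decide)) (hE 0 2 (by decide)) (hE 1 2 (by decide))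

theorem kkwFree_of_hasDichotomy {α : ℕ+ → ℕ+} {c D : ℕ} (hD : HasDichotomy (shiftWord α))
    (hL : LinkBound (shiftWord α) c D) (ha : ∀ x, shiftWord α x ≠ shiftWord α (x + 1)) :
    KKWFree (pathStarClass α) := by
  -- A biclique of size four has a star with four neighbours, one more than a subdivided wall
  -- allows.
  obtain ⟨N, hN⟩ := hD 4
  have hdeg : max D 3 + 1 ≤ N + c + D + 5 := by omega
  -- Large enough for `c + 1` branch vertices, for degree `max D 3 + 1` (the last `1` because a
  -- vertex of `K_n` has degree `n - 1`), and for a wall that forces a bag larger than `N`.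
  refine ⟨N + c + D + 5 + 1, fun V G ⟨_, ⟨e₀⟩⟩ => ?_⟩
  have e : G ↪g starPath (shiftWord α) := e₀.trans (shiftEmbedding α)
  refine ⟨?_, ?_, ?_, ?_⟩
  · refine not_isSubdivision_of_linkBound hL e
      (Fin.castLE_injective (show c + 1 ≤ N + c + D + 5 + 1 by omega)) fun w => ?_
    refine ⟨fun i => w.succAbove (Fin.castLE hdeg i),
      w.succAbove_right_injective.comp (Fin.castLE_injective hdeg), fun i => ?_⟩
    exact (Fin.succAbove_ne _ _).symm
  · refine not_isSubdivision_of_linkBound hL e (Sum.inl_injective.comp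
      (Fin.castLE_injective (show c + 1 ≤ N + c + D + 5 + 1 by omega))) ?_
    have hdeg' : max D 3 + 1 ≤ N + c + D + 5 + 1 := by omega
    rintro (w | w)
    · exact ⟨fun i => .inr (Fin.castLE hdeg' i),
        Sum.inr_injective.comp (Fin.castLE_injective hdeg'), fun i => by simp⟩
    · exact ⟨fun i => .inl (Fin.castLE hdeg' i),
        Sum.inl_injective.comp (Fin.castLE_injective hdeg'), fun i => by simp⟩
  · rintro ⟨h⟩
    rcases hN V G e with hb | ⟨D', hD'⟩
    · obtain ⟨v, f, hf, hadj⟩ := hb.exists_degree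
      have := le_of_injective_of_encard_le (k := 3) hf (W := G.neighborSet v) hadj
        (h.encard_neighborSet_le (by norm_num) wall_encard_neighborSet_le v)
      omega
    · have := h.lt_of_rootedDecomposition D' hD'
      omega
  · rintro ⟨W, H, hH, ⟨φ⟩⟩
    exact not_lineGraph_of_isSubdivision_wall ha e (by omega) hH φ

theorem exists_sail_bound_of_hasDichotomy {α : ℕ+ → ℕ+} (hD : HasDichotomy (shiftWord α)) :
    ∃ f : ℕ → ℕ, ∀ (t : ℕ) (V : Type) (G : SimpleGraph V), pathStarClass α V G →
      (f t : ℕ∞) ≤ treewidth G → ContainsSubdividedSail t G := by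
  choose N hN using hD
  refine ⟨fun t => N t + 1, fun t V G ⟨_, ⟨e⟩⟩ htw => ?_⟩
  rcases hN t V G (e.trans (shiftEmbedding α)) with hb | ⟨D, hbag⟩
  · exact hb.containsSubdividedSail
  · have h1 := htw.trans (D.treewidth_le hbag)
    have h2 : N t + 1 ≤ N t := by exact_mod_cast h1
    omega

end KKWFreeness

/-! ### The word `ν` is a sawtooth -/

section Nu

theorem succ_shiftWord (α : ℕ+ → ℕ+) (x : ℕ) : shiftWord α x + 1 = (α x.succPNat : ℕ) :=
  PNat.natPred_add_one _

/-- The blocks `1 2 … (k + 2)` with `k < m`. -/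
def nuBlocks (m : ℕ) : List ℕ := (List.range m).flatMap fun k => List.range' 1 (k + 2)

theorem nuBlocks_succ (m : ℕ) : nuBlocks (m + 1) = nuBlocks m ++ List.range' 1 (m + 2) := by
  simp [nuBlocks, List.range_succ, List.flatMap_append]

theorem le_length_nuBlocks (m : ℕ) : m ≤ (nuBlocks m).length := by
  induction m with
  | zero => simp
  | succ m ih =>
    rw [nuBlocks_succ, List.length_append, List.length_range']
    omega

theorem nuBlocks_getElem?_of_le {m n i : ℕ} (hmn : m ≤ n) (hi : i < (nuBlocks m).length) :
    (nuBlocks n)[i]? = (nuBlocks m)[i]? := by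
  induction n, hmn using Nat.le_induction with
  | base => rfl
  | succ n hmn ih =>
    have : (nuBlocks m).length ≤ (nuBlocks n).length := by
      clear ih
      induction n, hmn using Nat.le_induction with
      | base => rfl
      | succ n _ ih => rw [nuBlocks_succ, List.length_append]; omega
    rw [nuBlocks_succ, List.getElem?_append_left (by omega), ih]

theorem getElem?_nuBlocks_eq {m x : ℕ} (hx : x < (nuBlocks m).length) :
    (nuBlocks m)[x]? = some (shiftWord nu x + 1) := by
  have h1 : (nuBlocks (x + 1))[x]? = some (nu x.succPNat : ℕ) := nu_coe x.succPNat
  rw [succ_shiftWord, ← h1]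
  rcases le_total m (x + 1) with h | h
  · exact (nuBlocks_getElem?_of_le h hx).symm
  · exact nuBlocks_getElem?_of_le h (lt_of_lt_of_le (Nat.lt_succ_self x) (le_length_nuBlocks _))

/-- Every position of `ν` lies in some block. -/
theorem exists_nuBlock (x : ℕ) :
    ∃ m i, x = (nuBlocks m).length + i ∧ i < m + 2 := by
  by_contra hcon
  push Not at hcon
  have key : ∀ m, (nuBlocks m).length ≤ x := by
    intro m
    induction m with
    | zero => simp [nuBlocks]
    | succ m ih =>
      have := hcon m (x - (nuBlocks m).length) (by omega)
      rw [nuBlocks_succ, List.length_append, List.length_range']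
      omega
  have := key (x + 1)
  have := le_length_nuBlocks (x + 1)
  omega

theorem shiftWord_nu_block {m i : ℕ} (hi : i < m + 2) :
    shiftWord nu ((nuBlocks m).length + i) = i := by
  have h := getElem?_nuBlocks_eq (m := m + 1) (x := (nuBlocks m).length + i)
    (by rw [nuBlocks_succ, List.length_append, List.length_range']; omega)
  rw [nuBlocks_succ, List.getElem?_append_right (by omega), Nat.add_sub_cancel_left,
    List.getElem?_range' hi] at h
  have := Option.some.inj h
  omega

/-- Each block has at least two letters, so a reset never follows the letter `0`; this makes
consecutive letters differ. -/
theorem shiftWord_nu_succ (x : ℕ) : shiftWord nu (x + 1) = shiftWord nu x + 1 ∨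
    shiftWord nu (x + 1) = 0 ∧ shiftWord nu x ≠ 0 := by
  obtain ⟨m, i, rfl, hi⟩ := exists_nuBlock x
  rw [shiftWord_nu_block hi]
  by_cases hi' : i + 1 < m + 2
  · left
    rw [add_assoc, shiftWord_nu_block hi']
  · right
    have h1 : (nuBlocks m).length + i + 1 = (nuBlocks (m + 1)).length + 0 := by
      rw [nuBlocks_succ, List.length_append, List.length_range']
      omega
    rw [h1, shiftWord_nu_block (by omega)]
    omega

theorem isSawtooth_nu : IsSawtooth (shiftWord nu) :=
  ⟨by simpa [nuBlocks] using shiftWord_nu_block (m := 0) (i := 0) (by omega),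
    fun x => (shiftWord_nu_succ x).imp_right And.left⟩

theorem shiftWord_nu_ne (x : ℕ) : shiftWord nu x ≠ shiftWord nu (x + 1) := by
  have := shiftWord_nu_succ x
  omega

end Nu

/-! ### The words `κ(q)` are hierarchical -/

section Kappa

variable {q : ℕ}

theorem shiftWord_kappa (hq : 2 ≤ q) {k j b x : ℕ} (hj : 0 < j) (hjq : j < q)
    (hx : x + 1 = q ^ k * (q * b + j)) : shiftWord (kappa q) x = k * (q - 1) + (j - 1) := by
  have hmul : multiplicity q (x + 1) = k := by
    refine multiplicity_eq_of_dvd_of_not_dvd (Dvd.intro _ hx.symm) fun hdvd => ?_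
    rw [hx, pow_succ, Nat.mul_dvd_mul_iff_left (by positivity)] at hdvd
    exact Nat.not_dvd_of_pos_of_lt hj hjq ((Nat.dvd_add_right (Dvd.intro _ rfl)).1 hdvd)
  have h1 := succ_shiftWord (kappa q) x
  rw [kappa_coe hq, Nat.succPNat_coe, Nat.succ_eq_add_one, hmul, hx,
    Nat.mul_div_cancel_left _ (by positivity), Nat.mul_add_mod, Nat.mod_eq_of_lt hjq] at h1
  omega

theorem exists_kappa_form (hq : 2 ≤ q) (x : ℕ) :
    ∃ k j b, 0 < j ∧ j < q ∧ x + 1 = q ^ k * (q * b + j) := by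
  have hf : FiniteMultiplicity q (x + 1) := Nat.finiteMultiplicity_iff.2 ⟨by omega, by omega⟩
  obtain ⟨c, hc, hnd⟩ := hf.exists_eq_pow_mul_and_not_dvd
  refine ⟨multiplicity q (x + 1), c % q, c / q, Nat.pos_of_ne_zero fun h => hnd (Nat.dvd_of_mod_eq_zero h),
    Nat.mod_lt _ (by omega), ?_⟩
  rw [Nat.div_add_mod]
  exact hc

/-- Write `l = k (q - 1) + r` with `r < q - 1`. Letters from `l + (q - 1)` on sit at multiples of `q
^ (k + 1)`, and adding `(r + 1) q ^ k` to such a multiple gives the letter `l` before the next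
multiple. -/
theorem isHierarchical_kappa (hq : 2 ≤ q) : IsHierarchical (shiftWord (kappa q)) (q - 1) := by
  intro l y z hyz hy hz
  have hdvd : ∀ w, l + (q - 1) ≤ shiftWord (kappa q) w → q ^ (l / (q - 1) + 1) ∣ w + 1 := by
    intro w hw
    obtain ⟨k, j, b, hj, hjq, hx⟩ := exists_kappa_form hq w
    rw [shiftWord_kappa hq hj hjq hx] at hw
    rw [hx]
    refine Dvd.dvd.mul_right (pow_dvd_pow q ?_) _
    have h1 : l < k * (q - 1) := by omega
    have := (Nat.div_lt_iff_lt_mul (by omega)).2 h1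
    omega
  obtain ⟨Y, hY⟩ := hdvd y hy
  obtain ⟨Z, hZ⟩ := hdvd z hz
  set k := l / (q - 1)
  have hr : l % (q - 1) < q - 1 := Nat.mod_lt _ (by omega)
  have hl : k * (q - 1) + l % (q - 1) = l := Nat.div_add_mod' l (q - 1)
  set r := l % (q - 1)
  have hpos : 0 < q ^ k := by positivity
  have hform : y + 1 + q ^ k * (r + 1) = q ^ k * (q * Y + (r + 1)) := by
    rw [hY]; ring
  have hYZ : Y + 1 ≤ Z := by
    by_contra hlt
    have := Nat.mul_le_mul_left (q ^ (k + 1)) (show Z ≤ Y by omega)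
    omega
  have h2 : q ^ (k + 1) * (Y + 1) ≤ z + 1 := hZ ▸ Nat.mul_le_mul_left _ hYZ
  have h3 : q ^ k * (r + 1) ≤ q ^ k * q := Nat.mul_le_mul_left _ (by omega)
  have h4 : q ^ (k + 1) * (Y + 1) = y + 1 + q ^ k * q := by rw [hY]; ring
  refine ⟨y + q ^ k * (r + 1), by omega, by omega, ?_⟩
  rw [shiftWord_kappa hq (k := k) (j := r + 1) (b := Y) (by omega) (by omega) (by omega)]
  simpa using hl

/-- Equal letters mean equal numbers `k` of trailing zeros and equal last non-zero digits. For
consecutive numbers the former forces `k = 0`, and then the latter makes `q` divide `1`. -/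
theorem shiftWord_kappa_ne (hq : 2 ≤ q) (x : ℕ) :
    shiftWord (kappa q) x ≠ shiftWord (kappa q) (x + 1) := by
  intro heq
  obtain ⟨k, j, b, hj, hjq, hx⟩ := exists_kappa_form hq x
  obtain ⟨k', j', b', hj', hjq', hx'⟩ := exists_kappa_form hq (x + 1)
  rw [shiftWord_kappa hq hj hjq hx, shiftWord_kappa hq hj' hjq' hx'] at heq
  have hq1 : 0 < q - 1 := by omega
  have hdiv : ∀ k j, 0 < j → j < q → (k * (q - 1) + (j - 1)) / (q - 1) = k := fun k j hj hjq => by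
    rw [mul_comm, Nat.mul_add_div hq1, Nat.div_eq_of_lt (by omega), add_zero]
  have hk : k = k' := by
    rw [← hdiv k j hj hjq, heq, hdiv k' j' hj' hjq']
  subst hk
  have hj0 : j = j' := by omega
  subst hj0
  have h1 : q ^ k ∣ 1 := by
    rw [← Nat.dvd_add_right (Dvd.intro _ hx.symm : q ^ k ∣ x + 1)]
    exact Dvd.intro _ hx'.symm
  have h2 : q ^ k = 1 := Nat.dvd_one.1 h1
  rw [h2, one_mul] at hx hx'
  have h3 : q ∣ 1 := by
    rw [← Nat.dvd_add_right (Dvd.intro b rfl : q ∣ q * b)]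
    exact ⟨b', by omega⟩
  have := Nat.le_of_dvd one_pos h3
  omega

end Kappa

/-! ### The word `η` is hierarchical -/

section Eta

theorem getLast?_zeckendorf (x : ℕ) :
    (Nat.zeckendorf (x + 1)).getLast? = some (shiftWord eta x + 2) := by
  have h := eta_coe x.succPNat
  rw [← succ_shiftWord] at h
  exact h

/-- If all terms of the Zeckendorf representation of `y` are large compared with `d`, the
representation of `y + d` is obtained by joining those of `y` and `d`. -/
theorem zeckendorf_add {y d i : ℕ} (hy : i + 2 ≤ shiftWord eta y + 2) (hd : d < Nat.fib (i + 1)) :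
    Nat.zeckendorf (y + 1 + d) = Nat.zeckendorf (y + 1) ++ Nat.zeckendorf d := by
  have h1 := Nat.isZeckendorfRep_zeckendorf (y + 1)
  have h2 := Nat.isZeckendorfRep_zeckendorf d
  have h3 : (Nat.zeckendorf (y + 1) ++ Nat.zeckendorf d).IsZeckendorfRep := by
    unfold List.IsZeckendorfRep at h1 h2 ⊢
    rw [List.append_assoc, List.isChain_append]
    refine ⟨h1.left_of_append, h2, fun a ha b hb => ?_⟩
    rw [getLast?_zeckendorf] at ha
    obtain rfl := Option.some.inj ha
    refine le_trans (Nat.add_le_add_right ?_ 2) hy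
    -- `List.IsZeckendorfRep` tests the list with `0` appended; for `d = 0` the next entry `b` is
    -- that `0`.
    rcases Nat.eq_zero_or_pos d with rfl | hd0
    · simp at hb; omega
    · rw [Nat.zeckendorf_of_pos hd0] at hb
      simp only [List.cons_append, List.head?_cons, Option.mem_def, Option.some.injEq] at hb
      rw [← hb, ← Nat.lt_succ_iff]
      exact Nat.greatestFib_lt.2 hd
  conv_lhs => rw [← Nat.sum_zeckendorf_fib (y + 1), ← Nat.sum_zeckendorf_fib d, ← List.sum_append,
    ← List.map_append]
  exact Nat.zeckendorf_sum_fib h3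

theorem shiftWord_eta_add {y d i : ℕ} (hy : i + 2 ≤ shiftWord eta y + 2)
    (hd : d + 1 < Nat.fib (i + 1)) : shiftWord eta (y + (d + 1)) = shiftWord eta d := by
  have h := getLast?_zeckendorf (y + (d + 1))
  rw [show y + (d + 1) + 1 = y + 1 + (d + 1) by omega, zeckendorf_add hy hd,
    List.getLast?_append, getLast?_zeckendorf d] at h
  simpa using h.symm

theorem shiftWord_eta_lt {d i : ℕ} (hd : d + 1 < Nat.fib (i + 1)) : shiftWord eta d + 2 ≤ i := by
  have h1 := Nat.isZeckendorfRep_zeckendorf (d + 1)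
  have h2 := getLast?_zeckendorf d
  have h3 : Nat.fib (shiftWord eta d + 2) ≤ d + 1 := by
    conv_rhs => rw [← Nat.sum_zeckendorf_fib (d + 1)]
    exact List.single_le_sum (fun _ _ => Nat.zero_le _) _
      (List.mem_map_of_mem (List.mem_of_getLast? h2))
  by_contra hlt
  have := Nat.fib_mono (show i + 1 ≤ shiftWord eta d + 2 by omega)
  omega

theorem shiftWord_eta_fib (l : ℕ) : shiftWord eta (Nat.fib (l + 2) - 1) = l := by
  have h := getLast?_zeckendorf (Nat.fib (l + 2) - 1)
  have hpos : 0 < Nat.fib (l + 2) := Nat.fib_pos.2 (by omega)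
  have hrep : [l + 2].IsZeckendorfRep := by simp [List.IsZeckendorfRep]
  have h2 := Nat.zeckendorf_sum_fib hrep
  simp only [List.map_cons, List.map_nil, List.sum_cons, List.sum_nil, add_zero] at h2
  rw [Nat.sub_add_cancel hpos, h2] at h
  simpa using h.symm

/-- After a letter at least `l + 2`, the Zeckendorf representations of the next numbers arise by
appending those of `1, 2, …`. So the letter `l` appears after `fib (l + 2)` steps, and all letters
before that are too small to be at least `l + 2`. -/
theorem isHierarchical_eta : IsHierarchical (shiftWord eta) 2 := by
  intro l y z hyz hy hz
  have hpos : 0 < Nat.fib (l + 2) := Nat.fib_pos.2 (by omega)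
  have hlt : Nat.fib (l + 2) < Nat.fib (l + 3) := Nat.fib_lt_fib_succ (by omega)
  have key : ∀ d, d + 1 < Nat.fib (l + 3) → shiftWord eta (y + (d + 1)) = shiftWord eta d :=
    fun d hd => shiftWord_eta_add (i := l + 2) (by omega) hd
  refine ⟨y + Nat.fib (l + 2), by omega, ?_, ?_⟩
  · by_contra hcon
    obtain ⟨d, rfl⟩ : ∃ d, z = y + (d + 1) := ⟨z - y - 1, by omega⟩
    have h1 : d + 1 < Nat.fib (l + 3) := by omega
    rw [key d h1] at hz
    have := shiftWord_eta_lt (i := l + 2) h1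
    omega
  · have := key (Nat.fib (l + 2) - 1) (by omega)
    rwa [Nat.sub_add_cancel hpos, shiftWord_eta_fib] at this

/-- Let `fib (l + 2)` be the last term for the later number. Subtracting one replaces it by the
representation of `fib (l + 2) - 1`. If that is positive, the new last index is smaller; if it is
zero, the preceding term becomes the last, with a larger index. -/
theorem shiftWord_eta_ne (x : ℕ) : shiftWord eta x ≠ shiftWord eta (x + 1) := by
  set l := shiftWord eta (x + 1) with hl
  have hpos : 0 < Nat.fib (l + 2) := Nat.fib_pos.2 (by omega)
  obtain ⟨init, hinit⟩ := List.getLast?_eq_some_iff.1 (getLast?_zeckendorf (x + 1))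
  have hsum := Nat.sum_zeckendorf_fib (x + 1 + 1)
  have hrep := Nat.isZeckendorfRep_zeckendorf (x + 1 + 1)
  rw [hinit, ← hl] at hsum hrep
  rw [List.map_append, List.sum_append] at hsum
  simp only [List.map_cons, List.map_nil, List.sum_cons, List.sum_nil, add_zero] at hsum
  rcases List.eq_nil_or_concat init with rfl | ⟨init', c, rfl⟩
  · simp only [List.map_nil, List.sum_nil, zero_add] at hsum
    have := shiftWord_eta_lt (d := x) (i := l + 1) (by rw [show l + 1 + 1 = l + 2 by rfl]; omega)
    omega
  · rw [List.concat_eq_append] at hsum hrep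
    unfold List.IsZeckendorfRep at hrep
    rw [List.append_assoc, List.isChain_append] at hrep
    obtain ⟨h1, -, h3⟩ := hrep
    have hc : l + 2 + 2 ≤ c := h3 c (by simp) (l + 2) (by simp)
    have h4 : (init' ++ [c]).IsZeckendorfRep := by
      unfold List.IsZeckendorfRep
      rw [List.isChain_append]
      refine ⟨h1, List.isChain_singleton _, fun a ha b hb => ?_⟩
      simp only [List.getLast?_append, List.getLast?_singleton, List.head?_cons, Option.mem_def,
        Option.some_or, Option.some.injEq] at ha hb
      omega
    have h5 := Nat.zeckendorf_sum_fib h4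
    have h6 : 0 < ((init' ++ [c]).map Nat.fib).sum := by
      have : 0 < Nat.fib c := Nat.fib_pos.2 (by omega)
      simp [this]
    obtain ⟨y, hy⟩ : ∃ y, ((init' ++ [c]).map Nat.fib).sum = y + 1 := ⟨_, (Nat.sub_add_cancel h6).symm⟩
    rw [hy] at h5 hsum
    have h7 := getLast?_zeckendorf y
    rw [h5] at h7
    simp only [List.getLast?_append, List.getLast?_singleton, Option.some_or,
      Option.some.injEq] at h7
    rcases Nat.lt_or_ge 1 (Nat.fib (l + 2)) with hf | hf
    · obtain ⟨d, hd⟩ : ∃ d, Nat.fib (l + 2) = d + 2 := ⟨_, (Nat.sub_add_cancel hf).symm⟩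
      have h8 : d + 1 < Nat.fib (l + 1 + 1) := by rw [show l + 1 + 1 = l + 2 by rfl]; omega
      have h9 := shiftWord_eta_add (y := y) (i := l + 1) (by omega) h8
      rw [show y + (d + 1) = x by omega] at h9
      have := shiftWord_eta_lt h8
      omega
    · rw [show x = y by omega]
      omega

end Eta

theorem mainTheorem1 :
    (KKWFree (pathStarClass nu) ∧
      (∀ q : ℕ, 2 ≤ q → KKWFree (pathStarClass (kappa q))) ∧
      KKWFree (pathStarClass eta)) ∧
    (∃ f : ℕ → ℕ, ∀ (t : ℕ) (V : Type) (G : SimpleGraph V), pathStarClass nu V G →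
      (f t : ℕ∞) ≤ treewidth G → ContainsSubdividedSail t G) ∧
    (∀ q : ℕ, 2 ≤ q →
      ∃ f : ℕ → ℕ, ∀ (t : ℕ) (V : Type) (G : SimpleGraph V), pathStarClass (kappa q) V G →
        (f t : ℕ∞) ≤ treewidth G → ContainsSubdividedSail t G) ∧
    (∃ f : ℕ → ℕ, ∀ (t : ℕ) (V : Type) (G : SimpleGraph V), pathStarClass eta V G →
      (f t : ℕ∞) ≤ treewidth G → ContainsSubdividedSail t G) := by
  refine ⟨⟨?_, fun q hq => ?_, ?_⟩, ?_, fun q hq => ?_, ?_⟩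
  · exact kkwFree_of_hasDichotomy isSawtooth_nu.hasDichotomy isSawtooth_nu.linkBound shiftWord_nu_ne
  · exact kkwFree_of_hasDichotomy (isHierarchical_kappa hq).hasDichotomy
      ((isHierarchical_kappa hq).linkBound (by omega)) (shiftWord_kappa_ne hq)
  · exact kkwFree_of_hasDichotomy isHierarchical_eta.hasDichotomy
      (isHierarchical_eta.linkBound (by omega)) shiftWord_eta_ne
  · exact exists_sail_bound_of_hasDichotomy isSawtooth_nu.hasDichotomy
  · exact exists_sail_bound_of_hasDichotomy (isHierarchical_kappa hq).hasDichotomy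
  · exact exists_sail_bound_of_hasDichotomy isHierarchical_eta.hasDichotomy
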